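/- Let $G=(V,E)$ be a connected undirected graph with at least two vertices (parallel edges and loops are allowed; simple graphs are a special case). The spanning connectivity game (SCG) on $G$ is the coalitional game whose players are the edges, where a coalition $C\subseteq E$ has value $v(C)=1$ if there is some $E'\subseteq C$ such that $(V,E')$ is a spanning tree of $G$, and $v(C)=0$ otherwise. A coalition structure is a partition $\pi$ of $E$; its social welfare is $v(\pi)=\sum_{C\in\pi}v(C)$, and it is optimal if $v(\pi)\ge v(\pi')$ for every coalition structure $\pi'$. The problem OptCS(SCG) is: given $G$ (as the numbers of vertices and edges, followed by the list of edges), compute an optimal coalition structure of the SCG on $G$ (as a list that gives for each edge a label of its coalition). **Proposition.** 1. OptCS(SCG) can be solved in polynomial time. 2. For each such $G$, the social welfare of every optimal coalition structure of the SCG on $G$ equals the maximum number of pairwise edge-disjoint spanning trees of $G$. 3. The maximum number of pairwise edge-disjoint spanning trees of $G$ can be computed in polynomial time. Here polynomial time means that a single deterministic random access machine program solves the problem on all inputs in a number of steps bounded by a polynomial in the bit length of the input; each constant assignment, addition, truncated subtraction, memory access and comparison counts as one step, and there is no multiplication instruction (this is polynomially equivalent to Turing machine time). -/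

import Mathlib

/-! ### Coalitional games and coalition structures -/

/-- A coalitional game on the finite player set `N`. -/
structure CoalitionalGame (N : Type*) where
  /-- the characteristic function -/
  v : Finset N → ℝ
  /-- the empty coalition has value zero -/
  v_empty : v ∅ = 0

/-- A coalition structure is a partition of the set of all players. -/
abbrev CoalitionStructure (N : Type*) [Fintype N] [DecidableEq N] : Type _ :=
  Finpartition (Finset.univ : Finset N)

namespace CoalitionalGame

/-- The social welfare attained by a coalition structure. -/
def welfare {N : Type*} [Fintype N] [DecidableEq N] (g : CoalitionalGame N)
    (π : CoalitionStructure N) : ℝ :=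
  ∑ C ∈ π.parts, g.v C

/-- A coalition structure is optimal if it attains the largest social welfare. -/
def IsOptimal {N : Type*} [Fintype N] [DecidableEq N] (g : CoalitionalGame N)
    (π : CoalitionStructure N) : Prop :=
  ∀ π' : CoalitionStructure N, g.welfare π' ≤ g.welfare π

end CoalitionalGame

/-! ### Spanning connectivity games

An undirected graph with vertex set `V` and edge set `E` is given by the map `ends : E → Sym2 V`
that sends an edge to its unordered pair of end points. Parallel edges and loops are allowed; a
simple graph `G` is the case `E = G.edgeSet`, `ends = Subtype.val`. -/

/-- `(V, T)` is a spanning tree: no loops, no parallel edges, connected on all of `V`, acyclic. -/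
def IsSpanningTree {V E : Type*} (ends : E → Sym2 V) (T : Finset E) : Prop :=
  Set.InjOn ends (T : Set E) ∧ (∀ e ∈ T, ¬ (ends e).IsDiag) ∧
    (SimpleGraph.fromEdgeSet (ends '' (T : Set E))).IsTree

open Classical in
/-- The spanning connectivity game: the players are the edges, and a coalition has value 1 if it
contains a spanning tree and 0 otherwise. With a single vertex the empty coalition would win, so
`V` has at least two elements. -/
noncomputable def spanningConnectivityGame {V E : Type*} [Nontrivial V] (ends : E → Sym2 V) :
    CoalitionalGame E where
  v C := if ∃ T : Finset E, T ⊆ C ∧ IsSpanningTree ends T then 1 else 0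
  v_empty := by
    refine if_neg ?_
    rintro ⟨T, hT, h⟩
    obtain rfl := Finset.subset_empty.1 hT
    have hc := h.2.2.connected.preconnected
    simp only [Finset.coe_empty, Set.image_empty, SimpleGraph.fromEdgeSet_empty] at hc
    exact not_subsingleton V (SimpleGraph.preconnected_bot_iff_subsingleton.1 hc)

/-- `k` is the size of some family of pairwise edge-disjoint spanning trees. -/
def HasDisjointSpanningTrees {V E : Type*} (ends : E → Sym2 V) (k : ℕ) : Prop :=
  ∃ F : Finset (Finset E), F.card = k ∧ (∀ T ∈ F, IsSpanningTree ends T) ∧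
    (F : Set (Finset E)).PairwiseDisjoint id

/-! ### Instances and their representation -/

/-- A connected graph with vertices `0, …, n - 1`, at least two of them, listed by its edges. -/
structure SCGInstance where
  /-- number of vertices -/
  n : ℕ
  /-- number of edges -/
  m : ℕ
  /-- the two end points of each edge, in either order -/
  pair : Fin m → Fin n × Fin n
  two_le : 2 ≤ n
  connected : (SimpleGraph.fromEdgeSet (Set.range fun e => s((pair e).1, (pair e).2))).Connected

namespace SCGInstance

instance (x : SCGInstance) : Nontrivial (Fin x.n) := Fin.nontrivial_iff_two_le.2 x.two_le

/-- The end points of an edge as an unordered pair. -/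
def ends (x : SCGInstance) (e : Fin x.m) : Sym2 (Fin x.n) := s((x.pair e).1, (x.pair e).2)

/-- The spanning connectivity game on the graph `x`. -/
noncomputable def game (x : SCGInstance) : CoalitionalGame (Fin x.m) :=
  spanningConnectivityGame x.ends

/-- The representation `n, m, u₀, w₀, u₁, w₁, …` by an edge list. -/
def encode (x : SCGInstance) : List ℕ :=
  x.n :: x.m :: (List.ofFn x.pair).flatMap fun q => [(q.1 : ℕ), (q.2 : ℕ)]

end SCGInstance

/-- The list `L` represents the coalition structure `π`: its `i`-th entry is a label of the
coalition of player `i`, and two players have the same label iff they share a coalition. -/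
def Represents {m : ℕ} (L : List ℕ) (π : CoalitionStructure (Fin m)) : Prop :=
  ∃ h : L.length = m, ∀ i j : Fin m,
    L.get (i.cast h.symm) = L.get (j.cast h.symm) ↔ ∃ C ∈ π.parts, i ∈ C ∧ j ∈ C

/-! ### Polynomial time on a random access machine

The machine has registers and arrays of natural numbers, with indirect addressing. Its instructions
are constants, addition, truncated subtraction, array access and comparison, each of unit cost.
There is no multiplication, so this uniform cost measure is polynomially related to the running
time of Turing machines. -/

namespace RAM

/-- Contents of the registers, and of the cells of the arrays. -/
@[ext] structure Store where
  /-- register contents -/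
  reg : ℕ → ℕ
  /-- `arr a i` is the content of cell `i` of array `a` -/
  arr : ℕ → ℕ → ℕ

namespace Store

/-- Overwrite a register. -/
def setReg (s : Store) (x c : ℕ) : Store where
  reg := Function.update s.reg x c
  arr := s.arr

/-- Overwrite an array cell. -/
def setArr (s : Store) (a i c : ℕ) : Store where
  reg := s.reg
  arr := Function.update s.arr a (Function.update (s.arr a) i c)

/-- At the start, array `0` holds the input, register `0` its length; all else is zero. -/
def start (L : List ℕ) : Store where
  reg x := if x = 0 then L.length else 0
  arr a i := if a = 0 then L.getD i 0 else 0

/-- At the end, the output is in array `1`, and its length is in register `1`. -/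
def output (s : Store) : List ℕ := (List.range (s.reg 1)).map (s.arr 1)

end Store

/-- Programs. The arguments `x y z` are registers, `a` is an array, `c` is a constant. -/
inductive Prog : Type
  /-- do nothing -/
  | skip : Prog
  /-- `x := c` -/
  | const (x c : ℕ) : Prog
  /-- `x := y + z` -/
  | add (x y z : ℕ) : Prog
  /-- `x := max (y - z) 0` -/
  | sub (x y z : ℕ) : Prog
  /-- `x := a[y]` -/
  | read (x a y : ℕ) : Prog
  /-- `a[x] := y` -/
  | write (a x y : ℕ) : Prog
  /-- first `p`, then `q` -/
  | seq (p q : Prog) : Prog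
  /-- if `x < y` then `p` else `q` -/
  | ifLt (x y : ℕ) (p q : Prog) : Prog
  /-- while `x < y` do `p` -/
  | whileLt (x y : ℕ) (p : Prog) : Prog

/-- `Exec p s t s'`: started in `s`, the program `p` halts after `t` steps in `s'`. -/
inductive Exec : Prog → Store → ℕ → Store → Prop
  | skip (s : Store) : Exec .skip s 1 s
  | const (x c : ℕ) (s : Store) : Exec (.const x c) s 1 (s.setReg x c)
  | add (x y z : ℕ) (s : Store) : Exec (.add x y z) s 1 (s.setReg x (s.reg y + s.reg z))
  | sub (x y z : ℕ) (s : Store) : Exec (.sub x y z) s 1 (s.setReg x (s.reg y - s.reg z))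
  | read (x a y : ℕ) (s : Store) : Exec (.read x a y) s 1 (s.setReg x (s.arr a (s.reg y)))
  | write (a x y : ℕ) (s : Store) : Exec (.write a x y) s 1 (s.setArr a (s.reg x) (s.reg y))
  | seq {p q : Prog} {s s' s'' : Store} {t t' : ℕ} :
      Exec p s t s' → Exec q s' t' s'' → Exec (.seq p q) s (t + t') s''
  | ifTrue {x y : ℕ} {p q : Prog} {s s' : Store} {t : ℕ} :
      s.reg x < s.reg y → Exec p s t s' → Exec (.ifLt x y p q) s (t + 1) s'
  | ifFalse {x y : ℕ} {p q : Prog} {s s' : Store} {t : ℕ} :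
      ¬ s.reg x < s.reg y → Exec q s t s' → Exec (.ifLt x y p q) s (t + 1) s'
  | whileTrue {x y : ℕ} {p : Prog} {s s' s'' : Store} {t t' : ℕ} :
      s.reg x < s.reg y → Exec p s t s' → Exec (.whileLt x y p) s' t' s'' →
        Exec (.whileLt x y p) s (t + t' + 1) s''
  | whileFalse {x y : ℕ} {p : Prog} {s : Store} :
      ¬ s.reg x < s.reg y → Exec (.whileLt x y p) s 1 s

/-- Programs are deterministic. -/
theorem Exec.unique {p : Prog} {s s₁ : Store} {t₁ : ℕ} (h₁ : Exec p s t₁ s₁) :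
    ∀ {t₂ : ℕ} {s₂ : Store}, Exec p s t₂ s₂ → t₁ = t₂ ∧ s₁ = s₂ := by
  induction h₁ with
  | seq _ _ ih₁ ih₂ =>
    intro t₂ s₂ h₂
    cases h₂ with
    | seq a b =>
      obtain ⟨rfl, rfl⟩ := ih₁ a
      obtain ⟨rfl, rfl⟩ := ih₂ b
      exact ⟨rfl, rfl⟩
  | ifTrue hlt _ ih =>
    intro t₂ s₂ h₂
    cases h₂ with
    | ifTrue _ a => obtain ⟨rfl, rfl⟩ := ih a; exact ⟨rfl, rfl⟩
    | ifFalse hn _ => exact absurd hlt hn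
  | ifFalse hn _ ih =>
    intro t₂ s₂ h₂
    cases h₂ with
    | ifTrue hlt _ => exact absurd hlt hn
    | ifFalse _ a => obtain ⟨rfl, rfl⟩ := ih a; exact ⟨rfl, rfl⟩
  | whileTrue hlt _ _ ih₁ ih₂ =>
    intro t₂ s₂ h₂
    cases h₂ with
    | whileTrue _ a b =>
      obtain ⟨rfl, rfl⟩ := ih₁ a
      obtain ⟨rfl, rfl⟩ := ih₂ b
      exact ⟨rfl, rfl⟩
    | whileFalse hn => exact absurd hlt hn
  | whileFalse hn =>
    intro t₂ s₂ h₂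
    cases h₂ with
    | whileTrue hlt _ _ => exact absurd hlt hn
    | whileFalse _ => exact ⟨rfl, rfl⟩
  | _ => intro t₂ s₂ h₂; cases h₂; exact ⟨rfl, rfl⟩

/-- The length of a list of numbers written in binary, with one separator per number. -/
def bitLength (L : List ℕ) : ℕ := (L.map fun c => c.size + 1).sum

/-- The search problem with instances `x : I`, given as `enc x`, and with valid answers `Sol x` is
solvable in polynomial time: a single program halts on every instance after a number of steps that
is polynomial in the length of the input, and its output is a valid answer. -/
def SolvableInPolyTime {I : Type*} (enc : I → List ℕ) (Sol : I → List ℕ → Prop) : Prop :=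
  ∃ (P : Prog) (f : Polynomial ℕ), ∀ x : I, ∃ (t : ℕ) (s : Store),
    Exec P (Store.start (enc x)) t s ∧ t ≤ f.eval (bitLength (enc x)) ∧ Sol x s.output

end RAM

/-!
# Optimal coalition structures of spanning connectivity games

The social welfare of a coalition structure is the number of its coalitions that contain a spanning
tree. Choosing a tree in each of these yields disjoint spanning trees, and conversely disjoint
spanning trees are separated by a suitable partition of the edges. Hence the optimal welfare is the
largest number of disjoint spanning trees (`exists_isGreatest_of_isOptimal`), and a colouring of the
edges by this many colours, all of which contain a spanning tree, is an optimal coalition structure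
(`card_le_welfare_labelPartition`). It remains to find such a colouring in polynomial time, which is
done by matroid partition.

*The combinatorial algorithm.* The graphic matroid is represented by the vectors
`single (u e) 1 - single (w e) 1` over `ℚ`. The algorithm keeps a partial colouring by `k` forests.
Its layers are the decreasing sets `S₀ ⊇ S₁ ⊇ …`, where `S₀` consists of all edges and `Sₜ₊₁` of the
edges in `Sₜ` that each colour spans within `Sₜ`; they are stationary after `m` steps, where `m` is
the number of edges. Consider an uncoloured edge `e` of minimal level, that is, one that leaves the
sequence first. If `e ∉ S₁`, then some colour does not span `e`, and `e` receives this colour. If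
`e` leaves the sequence later, then there is an edge `f` of lower level `r` that lies on a circuit
formed by `e` and edges of the colour of `f` in `Sᵣ` (`exists_isExchange`). Giving the colour of `f`
to `e` instead does not change the layers up to `Sᵣ₊₁` (`IsExchange.layer_eq`), so the minimal
level of an uncoloured edge decreases (`IsExchange.potential_lt`). No shortest augmenting paths are
needed. If no uncoloured edge ever leaves the sequence, let `S` be the last layer. Each of `k`
disjoint spanning trees has at least `rank E - rank S` edges outside `S`, and each of the `k`
colours has at most as many there; as all edges outside `S` are coloured, either all colours span or
there are no `k` disjoint spanning trees (`not_pairwiseDisjoint_spanning`). If all colours span, the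
colouring is saved and `k` is increased.

*The implementation.* Whether an edge is spanned by a set of edges is decided by marking the
vertices that are reachable from an end point, in `m` sweeps over the edges (`mem_sweeps_iff`).
Programs are verified by the predicate transformer `RAM.wp`, which also ensures that no loop is
iterated more than `B` times each time it is entered. The running time of a program is then at most
`RAM.Prog.cost B`, a polynomial in `B` (`RAM.exists_exec_of_wp`, `RAM.Prog.exists_polynomial_cost`).
Here `B` may be taken quadratic in `m`, and `m` is at most the length of the input.
-/

/-! ### Disjoint spanning trees and coalition structures -/

section Games

variable {V E : Type*} {ends : E → Sym2 V}

theorem IsSpanningTree.nonempty [Nontrivial V] {T : Finset E} (hT : IsSpanningTree ends T) :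
    T.Nonempty := by
  rw [Finset.nonempty_iff_ne_empty]
  rintro rfl
  have hc := hT.2.2.connected.preconnected
  simp only [Finset.coe_empty, Set.image_empty, SimpleGraph.fromEdgeSet_empty] at hc
  exact not_subsingleton V (SimpleGraph.preconnected_bot_iff_subsingleton.1 hc)

theorem HasDisjointSpanningTrees.mono {j k : ℕ} (h : HasDisjointSpanningTrees ends k)
    (hjk : j ≤ k) : HasDisjointSpanningTrees ends j := by
  obtain ⟨F, rfl, hF, hd⟩ := h
  obtain ⟨F', hF', rfl⟩ := Finset.exists_subset_card_eq hjk
  exact ⟨F', rfl, fun T hT => hF T (hF' hT), hd.subset (by exact_mod_cast hF')⟩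

/-- Each of the disjoint trees has an edge, so there are at most as many of them as edges. -/
theorem HasDisjointSpanningTrees.le_card [Nontrivial V] [Fintype E] {k : ℕ}
    (h : HasDisjointSpanningTrees ends k) : k ≤ Fintype.card E := by
  classical
  obtain ⟨F, rfl, hF, hd⟩ := h
  calc F.card = ∑ T ∈ F, 1 := by simp
    _ ≤ ∑ T ∈ F, T.card := Finset.sum_le_sum fun T hT => (hF T hT).nonempty.card_pos
    _ = (F.biUnion id).card := (Finset.card_biUnion hd).symm
    _ ≤ Fintype.card E := Finset.card_le_univ _

/-- Disjoint coalitions that each contain a spanning tree yield disjoint spanning trees. -/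
theorem hasDisjointSpanningTrees_of_pairwiseDisjoint [Nontrivial V] {ι : Type*} (J : Finset ι)
    (C : ι → Finset E)
    (hC : ∀ i ∈ J, ∃ T ⊆ C i, IsSpanningTree ends T)
    (hd : (J : Set ι).PairwiseDisjoint C) : HasDisjointSpanningTrees ends J.card := by
  classical
  choose! T hTC hT using hC
  have hd' : (J : Set ι).PairwiseDisjoint T := fun i hi j hj hij =>
    (hd hi hj hij).mono (hTC i hi) (hTC j hj)
  refine ⟨J.image T, Finset.card_image_of_injOn ?_, ?_, ?_⟩
  · intro i hi j hj hij
    by_contra hne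
    have h := hd' hi hj hne
    rw [Function.onFun, hij, disjoint_self] at h
    exact (hT j hj).nonempty.ne_empty h
  · simpa using hT
  · rw [Finset.coe_image]
    rintro _ ⟨i, hi, rfl⟩ _ ⟨j, hj, rfl⟩ hne
    exact hd' hi hj fun h => hne (h ▸ rfl)

variable [Fintype E] [DecidableEq E]

/-- The social welfare counts the winning coalitions. -/
theorem exists_welfare_eq [Nontrivial V] (π : CoalitionStructure E) :
    ∃ j : ℕ, (spanningConnectivityGame ends).welfare π = j ∧ HasDisjointSpanningTrees ends j := by
  classical
  refine ⟨(π.parts.filter fun C => ∃ T : Finset E, T ⊆ C ∧ IsSpanningTree ends T).card, ?_, ?_⟩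
  · simp [CoalitionalGame.welfare, spanningConnectivityGame]
  · refine hasDisjointSpanningTrees_of_pairwiseDisjoint _ id (fun C hC => ?_) ?_
    · simpa using (Finset.mem_filter.1 hC).2
    · exact π.disjoint.subset fun C hC => (Finset.mem_filter.1 hC).1

open Classical in
/-- The coalition structure whose coalitions are the classes of equally labelled players. -/
noncomputable def labelPartition {ι : Type*} (f : E → ι) : CoalitionStructure E :=
  Finpartition.ofSetoid (Setoid.ker f)

theorem mem_part_labelPartition {ι : Type*} (f : E → ι) (i j : E) :
    j ∈ (labelPartition f).part i ↔ f i = f j := by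
  classical
  unfold labelPartition
  exact Finpartition.mem_part_ofSetoid_iff_rel

theorem exists_mem_labelPartition {ι : Type*} (f : E → ι) (i j : E) :
    (∃ C ∈ (labelPartition f).parts, i ∈ C ∧ j ∈ C) ↔ f i = f j := by
  rw [← mem_part_labelPartition]
  constructor
  · rintro ⟨C, hC, hi, hj⟩
    rwa [(labelPartition f).part_eq_of_mem hC hi]
  · intro h
    exact ⟨(labelPartition f).part i, (labelPartition f).part_mem.2 (Finset.mem_univ i),
      (labelPartition f).mem_part (Finset.mem_univ i), h⟩

/-- If, for each label in `J`, the players with that label contain a spanning tree, then the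
welfare is at least the number of these labels. -/
theorem card_le_welfare_labelPartition [Nontrivial V] {ι : Type*} (f : E → ι) (J : Finset ι)
    (hJ : ∀ c ∈ J, ∃ T : Finset E, (∀ e ∈ T, f e = c) ∧ IsSpanningTree ends T) :
    (J.card : ℝ) ≤ (spanningConnectivityGame ends).welfare (labelPartition f) := by
  classical
  choose! T hTf hT using hJ
  have hex : ∀ c ∈ J, ∃ C ∈ (labelPartition f).parts, T c ⊆ C := by
    intro c hc
    obtain ⟨a, ha⟩ := (hT c hc).nonempty
    refine ⟨(labelPartition f).part a, (labelPartition f).part_mem.2 (Finset.mem_univ a),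
      fun b hb => ?_⟩
    obtain ⟨C, hC, haC, hbC⟩ := (exists_mem_labelPartition f a b).2
      ((hTf c hc a ha).trans (hTf c hc b hb).symm)
    rwa [(labelPartition f).part_eq_of_mem hC haC]
  choose! C hC hTC using hex
  have hinj : Set.InjOn C J := by
    intro c hc d hd h
    obtain ⟨a, ha⟩ := (hT c hc).nonempty
    obtain ⟨b, hb⟩ := (hT d hd).nonempty
    have := (exists_mem_labelPartition f a b).1 ⟨C c, hC c hc, hTC c hc ha, h ▸ hTC d hd hb⟩
    rw [← hTf c hc a ha, this, hTf d hd b hb]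
  have hv : ∀ c ∈ J, (spanningConnectivityGame ends).v (C c) = 1 := fun c hc =>
    if_pos ⟨T c, hTC c hc, hT c hc⟩
  calc (J.card : ℝ) = ∑ c ∈ J, (spanningConnectivityGame ends).v (C c) := by
        rw [Finset.sum_congr rfl hv]; simp
    _ = ∑ D ∈ J.image C, (spanningConnectivityGame ends).v D := by
        rw [Finset.sum_image hinj]
    _ ≤ _ := by
        refine Finset.sum_le_sum_of_subset_of_nonneg (Finset.image_subset_iff.2 hC) ?_
        intro D _ _
        simp only [spanningConnectivityGame]
        split_ifs <;> norm_num

theorem HasDisjointSpanningTrees.exists_le_welfare [Nontrivial V] {j : ℕ}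
    (h : HasDisjointSpanningTrees ends j) :
    ∃ π : CoalitionStructure E, (j : ℝ) ≤ (spanningConnectivityGame ends).welfare π := by
  classical
  obtain ⟨F, rfl, hF, hd⟩ := h
  -- Each edge is labelled by the tree that contains it, or by `∅` if there is none.
  refine ⟨labelPartition fun e => (F.filter (e ∈ ·)).sup id, card_le_welfare_labelPartition _ F ?_⟩
  refine fun T hT => ⟨T, fun e he => ?_, hF T hT⟩
  have : F.filter (e ∈ ·) = {T} := by
    ext T'
    simp only [Finset.mem_filter, Finset.mem_singleton]
    refine ⟨fun h => ?_, fun h => h ▸ ⟨hT, he⟩⟩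
    by_contra hne
    exact Finset.disjoint_left.1 (hd h.1 hT hne) h.2 he
  simp [this]

/-- The welfare of every optimal coalition structure is the largest number of disjoint spanning
trees. -/
theorem exists_isGreatest_of_isOptimal [Nontrivial V] {π : CoalitionStructure E}
    (hπ : (spanningConnectivityGame ends).IsOptimal π) :
    ∃ k : ℕ, (spanningConnectivityGame ends).welfare π = k ∧
      IsGreatest {j | HasDisjointSpanningTrees ends j} k := by
  obtain ⟨k, hk, hd⟩ := exists_welfare_eq (ends := ends) π
  refine ⟨k, hk, hd, fun j hj => ?_⟩
  obtain ⟨π', hπ'⟩ := hj.exists_le_welfare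
  exact_mod_cast (hπ'.trans (hπ π')).trans hk.le

end Games

/-! ### Linear closures -/

section LinearMatroid

variable {E W : Type*} [AddCommGroup W] [Module ℚ W] {v : E → W}

/-- The closure operator of the matroid that the vectors `v e` represent over `ℚ`. -/
def linClosure (v : E → W) (A : Set E) : Set E := {e | v e ∈ Submodule.span ℚ (v '' A)}

theorem linClosure_mono {A B : Set E} (h : A ⊆ B) : linClosure v A ⊆ linClosure v B :=
  fun _ he => Submodule.span_mono (Set.image_mono h) he

theorem subset_linClosure (A : Set E) : A ⊆ linClosure v A :=
  fun _ he => Submodule.subset_span (Set.mem_image_of_mem v he)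

theorem span_le_span_of_subset_linClosure {A B : Set E} (h : A ⊆ linClosure v B) :
    Submodule.span ℚ (v '' A) ≤ Submodule.span ℚ (v '' B) :=
  Submodule.span_le.2 (Set.image_subset_iff.2 h)

theorem linClosure_subset_of_subset {A B : Set E} (h : A ⊆ linClosure v B) :
    linClosure v A ⊆ linClosure v B :=
  fun _ he => span_le_span_of_subset_linClosure h he

theorem linClosure_exchange {A : Set E} {e f : E} (h : e ∈ linClosure v (insert f A))
    (h' : e ∉ linClosure v A) : f ∈ linClosure v (insert e A) := by
  simp only [linClosure, Set.mem_ofPred_eq, Set.image_insert_eq] at *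
  exact mem_span_insert_exchange h h'

theorem LinearIndepOn.notMem_linClosure_diff {I : Set E} (hI : LinearIndepOn ℚ v I) {f : E}
    (hf : f ∈ I) : f ∉ linClosure v (I \ {f}) := by
  have := (linearIndepOn_insert (f := v) (s := I \ {f}) (a := f) (by simp)).1
    (by rwa [Set.insert_sdiff_singleton, Set.insert_eq_of_mem hf])
  exact this.2

/-- If `f` lies on a circuit of `A + e`, then exchanging `f` for `e` does not change the closure of
any set between `A` and `I`, nor the independence of `I`. -/
theorem LinearIndepOn.swap {I A : Set E} {e f : E} (hI : LinearIndepOn ℚ v I) (hA : A ⊆ I)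
    (hf : f ∈ A) (h : f ∈ linClosure v (insert e (A \ {f}))) :
    (∀ B, A ⊆ B → linClosure v (insert e (B \ {f})) = linClosure v B) ∧
      LinearIndepOn ℚ v (insert e (I \ {f})) := by
  have hfA : f ∉ linClosure v (A \ {f}) := fun h' =>
    hI.notMem_linClosure_diff (hA hf) (linClosure_mono (Set.sdiff_subset_sdiff_left hA) h')
  have heA : e ∈ linClosure v A := by
    simpa [Set.insert_eq_of_mem hf] using linClosure_exchange h hfA
  refine ⟨fun B hB => subset_antisymm ?_ ?_, ?_⟩
  · refine linClosure_subset_of_subset (Set.insert_subset (linClosure_mono hB heA) ?_)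
    exact Set.sdiff_subset.trans (subset_linClosure B)
  · refine linClosure_subset_of_subset fun g hg => ?_
    by_cases hgf : g = f
    · subst hgf
      exact linClosure_mono (Set.insert_subset_insert (Set.sdiff_subset_sdiff_left hB)) h
    · exact subset_linClosure _ (Or.inr ⟨hg, hgf⟩)
  · refine (hI.mono Set.sdiff_subset).insert fun he => ?_
    refine hI.notMem_linClosure_diff (hA hf) ?_
    refine linClosure_subset_of_subset (Set.insert_subset he (subset_linClosure _)) ?_
    exact linClosure_mono (Set.insert_subset_insert (Set.sdiff_subset_sdiff_left hA)) h

/-- If `A` spans `e` but `A ∩ S` does not, then some element of `A` outside `S` lies on a circuit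
of `A + e`. -/
theorem exists_mem_diff_mem_linClosure {A S : Set E} (hA : A.Finite) {e : E}
    (h : e ∈ linClosure v A) (h' : e ∉ linClosure v (A ∩ S)) :
    ∃ f ∈ A, f ∉ S ∧ f ∈ linClosure v (insert e (A \ {f})) := by
  -- Take a minimal subset of `A` that spans `e`.
  obtain ⟨B, hBA, hB⟩ := Set.Finite.exists_le_minimal
    (s := {B : Set E | B ⊆ A ∧ e ∈ linClosure v B})
    (hA.finite_subsets.subset fun B hB => hB.1) (a := A) ⟨subset_rfl, h⟩
  obtain ⟨f, hfB, hfS⟩ : ∃ f ∈ B, f ∉ S := by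
    by_contra! hcon
    exact h' (linClosure_mono (Set.subset_inter hB.prop.1 hcon) hB.prop.2)
  have hn : e ∉ linClosure v (B \ {f}) := fun hcon => by
    have := hB.le_of_le (y := B \ {f}) ⟨Set.sdiff_subset.trans hB.prop.1, hcon⟩ Set.sdiff_subset
    exact (this hfB).2 rfl
  refine ⟨f, hB.prop.1 hfB, hfS, ?_⟩
  refine linClosure_mono (Set.insert_subset_insert (Set.sdiff_subset_sdiff_left hB.prop.1)) ?_
  refine linClosure_exchange ?_ hn
  rw [Set.insert_sdiff_singleton, Set.insert_eq_of_mem hfB]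
  exact hB.prop.2

/-! ### Partial colourings by independent sets, and their layers -/

/-- A partial colouring of the ground set `X` with the colours `1, …, k`, where `0` means
uncoloured, such that each colour class is independent. -/
structure IsIndepColoring (v : E → W) (X : Finset E) (k : ℕ) (col : E → ℕ) : Prop where
  le : ∀ e ∈ X, col e ≤ k
  indep : ∀ i, 1 ≤ i → LinearIndepOn ℚ v (↑X ∩ col ⁻¹' {i})

/-- The layers of a colouring: the next layer consists of those elements of the present one that
are spanned by each colour class within the present layer. -/
def layer (v : E → W) (X : Finset E) (k : ℕ) (col : E → ℕ) : ℕ → Set E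
  | 0 => X
  | t + 1 => {e ∈ layer v X k col t |
      ∀ i, 1 ≤ i → i ≤ k → e ∈ linClosure v (layer v X k col t ∩ col ⁻¹' {i})}

open Classical in
/-- `level v X k col t e` is the index of the last of the layers `0, …, t` that contains `e`. -/
noncomputable def level (v : E → W) (X : Finset E) (k : ℕ) (col : E → ℕ) : ℕ → E → ℕ
  | 0, _ => 0
  | t + 1, e => if e ∈ layer v X k col (t + 1) then t + 1 else level v X k col t e

variable {X : Finset E} {k : ℕ} {col : E → ℕ}

theorem layer_succ_subset (t : ℕ) : layer v X k col (t + 1) ⊆ layer v X k col t :=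
  fun _ he => he.1

theorem layer_antitone : Antitone (layer v X k col) :=
  antitone_nat_of_succ_le layer_succ_subset

theorem layer_subset (t : ℕ) : layer v X k col t ⊆ X := layer_antitone (Nat.zero_le t)

/-- The sequence of layers becomes stationary before its length exceeds the number of elements. -/
theorem layer_card_succ : layer v X k col (X.card + 1) = layer v X k col X.card := by
  have key : ∀ t, layer v X k col (t + 1) = layer v X k col t ∨
      (layer v X k col (t + 1)).ncard + (t + 1) ≤ X.card := by
    have hfin : ∀ t, (layer v X k col t).Finite := fun t =>
      X.finite_toSet.subset (layer_subset t)
    intro t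
    induction t with
    | zero =>
      rcases (layer_succ_subset (v := v) (X := X) (k := k) (col := col) 0).eq_or_ssubset with h | h
      · exact Or.inl h
      · have := Set.ncard_lt_ncard h (hfin 0)
        rw [layer, Set.ncard_coe_finset] at this
        exact Or.inr this
    | succ t ih =>
      rcases ih with ih | ih
      · left
        conv_lhs => rw [layer, ih]
        rfl
      · rcases (layer_succ_subset (v := v) (X := X) (k := k) (col := col)
          (t + 1)).eq_or_ssubset with h | h
        · exact Or.inl h
        · have := Set.ncard_lt_ncard h (hfin _)
          right
          omega
  rcases key X.card with h | h
  · exact h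
  · omega

theorem level_le (t : ℕ) (e : E) : level v X k col t e ≤ t := by
  induction t with
  | zero => exact le_rfl
  | succ t ih => rw [level]; split_ifs <;> omega

theorem le_level_iff {s t : ℕ} (hst : s ≤ t) {e : E} (he : e ∈ X) :
    s ≤ level v X k col t e ↔ e ∈ layer v X k col s := by
  induction t with
  | zero =>
    obtain rfl : s = 0 := by omega
    simpa [level, layer] using he
  | succ t ih =>
    rw [level]
    split_ifs with h
    · exact iff_of_true hst (layer_antitone hst h)
    · rcases hst.eq_or_lt with rfl | hlt
      · have := level_le (v := v) (X := X) (k := k) (col := col) t e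
        exact iff_of_false (by omega) h
      · exact ih (by omega)

theorem mem_layer_level {t : ℕ} {e : E} (he : e ∈ X) :
    e ∈ layer v X k col (level v X k col t e) :=
  (le_level_iff (level_le t e) he).1 le_rfl

theorem notMem_layer_level_succ {t : ℕ} {e : E} (he : e ∈ X) (h : level v X k col t e < t) :
    e ∉ layer v X k col (level v X k col t e + 1) := fun hcon => by
  have := (le_level_iff h he).2 hcon
  omega

/-! ### Augmentation and exchange -/

theorem IsIndepColoring.update [DecidableEq E] (h : IsIndepColoring v X k col) {e : E} {c : ℕ}
    (h0 : col e = 0) (hc : 1 ≤ c) (hck : c ≤ k)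
    (hs : e ∉ linClosure v (↑X ∩ col ⁻¹' {c})) :
    IsIndepColoring v X k (Function.update col e c) := by
  refine ⟨fun g hg => ?_, fun i hi => ?_⟩
  · rcases eq_or_ne g e with rfl | hne
    · simpa using hck
    · simpa [hne] using h.le g hg
  · rcases eq_or_ne i c with rfl | hne
    · refine ((h.indep i hi).insert hs).mono ?_
      rintro g ⟨hgX, hg⟩
      rcases eq_or_ne g e with rfl | hge
      · exact Or.inl rfl
      · exact Or.inr ⟨hgX, by simpa [hge] using hg⟩
    · refine (h.indep i hi).mono ?_
      rintro g ⟨hgX, hg⟩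
      rcases eq_or_ne g e with rfl | hge
      · exact absurd (by simpa using hg) hne.symm
      · exact ⟨hgX, by simpa [hge] using hg⟩

/-- The exchanged colouring: `e` takes over the colour of `f`, which becomes uncoloured. -/
def swapColor [DecidableEq E] (col : E → ℕ) (e f : E) : E → ℕ :=
  Function.update (Function.update col e (col f)) f 0

theorem swapColor_preimage_of_ne [DecidableEq E] {e f : E} (h0 : col e = 0) {i : ℕ} (hi : 1 ≤ i)
    (hic : i ≠ col f) : swapColor col e f ⁻¹' {i} = col ⁻¹' {i} := by
  ext g
  rcases eq_or_ne g f with rfl | hgf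
  · simpa [swapColor, hic.symm] using fun h : 0 = i => by omega
  · rcases eq_or_ne g e with rfl | hge
    · simp only [swapColor, Set.mem_preimage, Set.mem_singleton_iff, h0]
      rw [Function.update_of_ne hgf, Function.update_self]
      exact iff_of_false hic.symm (by omega)
    · simp [swapColor, hgf, hge]

theorem inter_swapColor_preimage [DecidableEq E] {e f : E} (h0 : col e = 0) (hf : 1 ≤ col f)
    {B : Set E} (heB : e ∈ B) :
    B ∩ swapColor col e f ⁻¹' {col f} = insert e ((B ∩ col ⁻¹' {col f}) \ {f}) := by
  have hef : e ≠ f := by rintro rfl; omega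
  ext g
  rcases eq_or_ne g f with rfl | hgf
  · simpa [swapColor, hef.symm] using fun _ => by omega
  · rcases eq_or_ne g e with rfl | hge
    · simp [swapColor, hgf, heB]
    · simp [swapColor, hgf, hge]

/-- The exchange of `e` and `f` is admissible: `f` lies in a lower layer `r` than `e`, and on a
circuit that is formed by `e` and elements of the colour of `f` in layer `r`. -/
structure IsExchange [DecidableEq E] (v : E → W) (X : Finset E) (k : ℕ) (col : E → ℕ) (e f : E)
    (r : ℕ) : Prop where
  eq_zero : col e = 0
  colored : 1 ≤ col f
  mem_succ : e ∈ layer v X k col (r + 1)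
  mem : f ∈ layer v X k col r
  notMem : f ∉ layer v X k col (r + 1)
  circuit : f ∈ linClosure v (layer v X k col r ∩ swapColor col e f ⁻¹' {col f})

section Exchange

variable [DecidableEq E] {e f : E} {r : ℕ}

theorem IsExchange.swap (hx : IsExchange v X k col e f r) (h : IsIndepColoring v X k col) :
    (∀ B, layer v X k col r ⊆ B → B ⊆ X → ∀ i, 1 ≤ i →
      linClosure v (B ∩ swapColor col e f ⁻¹' {i}) = linClosure v (B ∩ col ⁻¹' {i})) ∧
      LinearIndepOn ℚ v (↑X ∩ swapColor col e f ⁻¹' {col f}) := by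
  have her : e ∈ layer v X k col r := layer_succ_subset r hx.mem_succ
  have hc := hx.circuit
  rw [inter_swapColor_preimage hx.eq_zero hx.colored her] at hc
  have key := (h.indep _ hx.colored).swap (e := e) (f := f)
    (A := layer v X k col r ∩ col ⁻¹' {col f})
    (Set.inter_subset_inter_left _ (layer_subset r)) ⟨hx.mem, rfl⟩ hc
  constructor
  · intro B hB _ i hi
    rcases eq_or_ne i (col f) with rfl | hne
    · rw [inter_swapColor_preimage hx.eq_zero hx.colored (hB her)]
      exact key.1 _ (Set.inter_subset_inter_left _ hB)
    · rw [swapColor_preimage_of_ne hx.eq_zero hi hne]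
  · rw [inter_swapColor_preimage hx.eq_zero hx.colored (layer_subset r her)]
    exact key.2

theorem IsExchange.isIndepColoring (hx : IsExchange v X k col e f r)
    (h : IsIndepColoring v X k col) : IsIndepColoring v X k (swapColor col e f) := by
  refine ⟨fun g hg => ?_, fun i hi => ?_⟩
  · rcases eq_or_ne g f with rfl | hgf
    · simp [swapColor]
    · rcases eq_or_ne g e with rfl | hge
      · simpa [swapColor, hgf] using h.le f (layer_subset r hx.mem)
      · simpa [swapColor, hgf, hge] using h.le g hg
  · rcases eq_or_ne i (col f) with rfl | hne
    · exact (hx.swap h).2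
    · rw [swapColor_preimage_of_ne hx.eq_zero hi hne]
      exact h.indep i hi

/-- An admissible exchange does not change the layers up to the first one that misses `f`. -/
theorem IsExchange.layer_eq (hx : IsExchange v X k col e f r) (h : IsIndepColoring v X k col)
    {t : ℕ} (ht : t ≤ r + 1) : layer v X k (swapColor col e f) t = layer v X k col t := by
  induction t with
  | zero => rfl
  | succ t ih =>
    rw [layer, layer, ih (by omega)]
    ext g
    refine and_congr_right fun _ => forall_congr' fun i => forall_congr' fun hi => ?_
    rw [(hx.swap h).1 _ (layer_antitone (by omega)) (layer_subset t) i hi]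

end Exchange

/-- An uncoloured element of positive level that is not in the last layer admits an exchange. -/
theorem exists_isExchange [DecidableEq E] {e : E} {t : ℕ} (he : e ∈ X) (h0 : col e = 0)
    (hpos : 0 < level v X k col t e) (hlt : level v X k col t e < t) :
    ∃ f ∈ X, level v X k col t f < level v X k col t e ∧
      IsExchange v X k col e f (level v X k col t f) := by
  have hmem := mem_layer_level (v := v) (k := k) (col := col) (t := t) he
  obtain ⟨i, hi, hik, hni⟩ : ∃ i, 1 ≤ i ∧ i ≤ k ∧
      e ∉ linClosure v (layer v X k col (level v X k col t e) ∩ col ⁻¹' {i}) := by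
    by_contra! hcon
    exact notMem_layer_level_succ he hlt ⟨hmem, hcon⟩
  -- Consider the first layer in which the colour `i` does not span `e`.
  classical
  have hex : ∃ s, e ∉ linClosure v (layer v X k col s ∩ col ⁻¹' {i}) := ⟨_, hni⟩
  obtain ⟨s, hs, hmin⟩ : ∃ s, e ∉ linClosure v (layer v X k col s ∩ col ⁻¹' {i}) ∧
      ∀ s' < s, e ∈ linClosure v (layer v X k col s' ∩ col ⁻¹' {i}) :=
    ⟨Nat.find hex, Nat.find_spec hex, fun s' h' => not_not.1 (Nat.find_min hex h')⟩
  have hst : s ≤ level v X k col t e := by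
    by_contra! hcon
    exact hni (hmin _ hcon)
  have hs0 : s ≠ 0 := by
    rintro rfl
    exact hs ((layer_antitone (v := v) (X := X) (k := k) (col := col) hpos hmem).2 i hi hik)
  obtain ⟨r, rfl⟩ := Nat.exists_eq_succ_of_ne_zero hs0
  have hsub : layer v X k col r ∩ col ⁻¹' {i} ∩ layer v X k col (r + 1) =
      layer v X k col (r + 1) ∩ col ⁻¹' {i} := by
    ext g
    have := @layer_succ_subset E W _ _ v X k col r g
    simp only [Set.mem_inter_iff]
    tauto
  obtain ⟨f, ⟨hfr, hfi⟩, hfr', hf⟩ := exists_mem_diff_mem_linClosure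
    (X.finite_toSet.subset (Set.inter_subset_left.trans (layer_subset r)))
    (hmin r (Nat.lt_succ_self r)) (by rwa [hsub])
  have hfX : f ∈ X := layer_subset r hfr
  obtain rfl : col f = i := hfi
  have hlev : level v X k col t f = r := by
    have h1 := (le_level_iff (t := t) (by omega) hfX).2 hfr
    have h2 := mt (le_level_iff (t := t) (by omega) hfX).1 hfr'
    omega
  have her : e ∈ layer v X k col (r + 1) := layer_antitone hst hmem
  refine ⟨f, hfX, by omega, h0, hi, hlev ▸ her, hlev ▸ hfr, hlev ▸ hfr', ?_⟩
  rw [hlev, inter_swapColor_preimage h0 hi (layer_succ_subset r her)]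
  exact hf

/-! ### The potential -/

/-- The uncoloured elements. -/
def uncolored (X : Finset E) (col : E → ℕ) : Finset E := X.filter (col · = 0)

theorem mem_uncolored {e : E} : e ∈ uncolored X col ↔ e ∈ X ∧ col e = 0 := Finset.mem_filter

/-- The smallest level of an uncoloured element, or the number of elements if this is smaller. -/
noncomputable def minLevel (v : E → W) (X : Finset E) (k : ℕ) (col : E → ℕ) : ℕ :=
  sInf (insert X.card (level v X k col X.card '' uncolored X col))

theorem minLevel_le_card : minLevel v X k col ≤ X.card := Nat.sInf_le (Set.mem_insert _ _)

theorem minLevel_le {e : E} (he : e ∈ X) (h0 : col e = 0) :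
    minLevel v X k col ≤ level v X k col X.card e :=
  Nat.sInf_le (Or.inr ⟨e, by simp [uncolored, he, h0], rfl⟩)

theorem minLevel_eq {b : ℕ} (hle : b ≤ X.card)
    (hmin : ∀ e ∈ X, col e = 0 → b ≤ level v X k col X.card e)
    (hb : b = X.card ∨ ∃ e ∈ X, col e = 0 ∧ level v X k col X.card e = b) :
    minLevel v X k col = b := by
  refine le_antisymm ?_ (le_csInf (Set.insert_nonempty _ _) ?_)
  · rcases hb with rfl | ⟨e, he, h0, rfl⟩
    · exact minLevel_le_card
    · exact minLevel_le he h0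
  · rintro _ (rfl | ⟨e, he, rfl⟩)
    · exact hle
    · have := Finset.mem_filter.1 (Finset.mem_coe.1 he)
      exact hmin e this.1 this.2

/-- The quantity that decreases in every round of the algorithm: the first factor does so when an
element is coloured or a colour is introduced, and the last summand, which is at most the number of
elements, does so in an exchange. -/
noncomputable def potential (v : E → W) (X : Finset E) (k : ℕ) (col : E → ℕ) : ℕ :=
  (X.card + 2 - k + (uncolored X col).card) * (X.card + 1) + minLevel v X k col

theorem potential_le :
    potential v X k col ≤ (2 * X.card + 2) * (X.card + 1) + X.card := by
  refine add_le_add (Nat.mul_le_mul_right _ ?_) minLevel_le_card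
  have := Finset.card_filter_le X (col · = 0)
  simp only [uncolored]
  omega

theorem potential_lt_of_lt {k' : ℕ} {col' : E → ℕ}
    (h : X.card + 2 - k' + (uncolored X col').card < X.card + 2 - k + (uncolored X col).card) :
    potential v X k' col' < potential v X k col := by
  have h1 : minLevel v X k' col' ≤ X.card := minLevel_le_card
  have h2 := Nat.mul_le_mul_right (X.card + 1) (Nat.succ_le_of_lt h)
  unfold potential
  rw [Nat.succ_mul] at h2
  omega

theorem potential_succ_lt (hk : k ≤ X.card) : potential v X (k + 1) col < potential v X k col :=
  potential_lt_of_lt (by omega)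

theorem potential_update_lt [DecidableEq E] {e : E} {c : ℕ} (he : e ∈ X) (h0 : col e = 0)
    (hc : 1 ≤ c) : potential v X k (Function.update col e c) < potential v X k col := by
  refine potential_lt_of_lt (Nat.add_lt_add_left (Finset.card_lt_card ?_) _)
  rw [Finset.ssubset_iff_of_subset]
  · exact ⟨e, by simp [uncolored, he, h0], by simp [uncolored]; omega⟩
  · intro g hg
    simp only [uncolored, Finset.mem_filter] at hg ⊢
    refine ⟨hg.1, ?_⟩
    rcases eq_or_ne g e with rfl | hge
    · exact h0
    · simpa [hge] using hg.2

theorem IsExchange.potential_lt [DecidableEq E] {e f : E} {r : ℕ}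
    (hx : IsExchange v X k col e f r) (h : IsIndepColoring v X k col)
    (hr : r < minLevel v X k col) :
    potential v X k (swapColor col e f) < potential v X k col := by
  have hfX : f ∈ X := layer_subset _ hx.mem
  have heX : e ∈ X := layer_subset _ hx.mem_succ
  have hc := hx.colored
  have hef : e ≠ f := by rintro rfl; have := hx.eq_zero; omega
  have hU : (uncolored X (swapColor col e f)).card = (uncolored X col).card := by
    have : uncolored X (swapColor col e f) = insert f ((uncolored X col).erase e) := by
      ext g
      rw [mem_uncolored, Finset.mem_insert, Finset.mem_erase, mem_uncolored]
      rcases eq_or_ne g f with rfl | hgf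
      · simp [swapColor, hfX]
      · rcases eq_or_ne g e with rfl | hge
        · simp only [swapColor, Function.update_of_ne hgf, Function.update_self]
          simp only [hgf, ne_eq, not_true_eq_false, false_and, or_false, iff_false]
          omega
        · simp [swapColor, hgf, hge]
    rw [this, Finset.card_insert_of_notMem (by simp [uncolored]; omega),
      Finset.card_erase_add_one (by simp [uncolored, heX, hx.eq_zero])]
  have hm : minLevel v X k (swapColor col e f) ≤ r := by
    refine (minLevel_le hfX (by simp [swapColor])).trans ?_
    by_contra! hcon
    have hrX : r + 1 ≤ X.card := hr.trans_le minLevel_le_card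
    have := (le_level_iff (v := v) (k := k) (col := swapColor col e f) hrX hfX).1 hcon
    rw [hx.layer_eq h le_rfl] at this
    exact hx.notMem this
  unfold potential
  rw [hU]
  omega

/-! ### Optimality of a colouring without augmentation -/

/-- The rank of a finite set in the matroid represented by `v`. -/
noncomputable def linRank (v : E → W) (A : Finset E) : ℕ :=
  Module.finrank ℚ (Submodule.span ℚ (v '' A))

instance finiteDimensional_span_image (A : Finset E) :
    FiniteDimensional ℚ (Submodule.span ℚ (v '' A)) :=
  FiniteDimensional.span_of_finite ℚ (A.finite_toSet.image v)

theorem linRank_mono {A B : Finset E} (h : ↑A ⊆ linClosure v B) : linRank v A ≤ linRank v B :=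
  Submodule.finrank_mono (span_le_span_of_subset_linClosure h)

theorem linRank_eq_card {A : Finset E} (hA : LinearIndepOn ℚ v (A : Set E)) :
    linRank v A = A.card := by
  have := finrank_span_eq_card (R := ℚ) (b := fun a : (A : Set E) => v a) hA
  rw [Set.range_comp' v, Subtype.range_coe] at this
  simpa [linRank] using this

theorem linRank_le_card (A : Finset E) : linRank v A ≤ A.card := by
  have := finrank_range_le_card (R := ℚ) (fun a : (A : Set E) => v a)
  rw [Set.finrank, Set.range_comp' v, Subtype.range_coe] at this
  simpa [linRank] using this

theorem linRank_union_le [DecidableEq E] (A B : Finset E) :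
    linRank v (A ∪ B) ≤ linRank v A + linRank v B := by
  rw [linRank, Finset.coe_union, Set.image_union, Submodule.span_union]
  exact Submodule.finrank_add_le_finrank_add_finrank _ _

theorem linRank_lt {A B : Finset E} (hAB : A ⊆ B) {e : E} (he : e ∈ B)
    (h : e ∉ linClosure v (A : Set E)) : linRank v A < linRank v B := by
  refine Submodule.finrank_lt_finrank_of_lt
    (lt_of_le_of_ne (Submodule.span_mono (Set.image_mono (Finset.coe_subset.2 hAB))) ?_)
  intro heq
  refine h ?_
  rw [linClosure, Set.mem_ofPred_eq, heq]
  exact Submodule.subset_span (Set.mem_image_of_mem v he)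

/-- Suppose that all uncoloured elements lie in the last layer and that some colour class does not
span. Then there are no `k` disjoint spanning sets. Each of them would have at least
`rank X - rank S` elements outside the last layer `S`, while all elements outside `S` are coloured,
and the colour classes have at most `rank X - rank S` elements each there, one of them fewer. -/
theorem not_pairwiseDisjoint_spanning {ι : Type*} (h : IsIndepColoring v X k col)
    (hU : ∀ e ∈ X, col e = 0 → e ∈ layer v X k col X.card) {i₀ : ℕ} (hi₀ : 1 ≤ i₀)
    (hi₀k : i₀ ≤ k) {e₀ : E} (he₀ : e₀ ∈ X) (hn : e₀ ∉ linClosure v (↑X ∩ col ⁻¹' {i₀}))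
    (J : Finset ι) (T : ι → Finset E) (hJ : J.card = k) (hTX : ∀ j ∈ J, T j ⊆ X)
    (hT : ∀ j ∈ J, ↑X ⊆ linClosure v (T j)) (hd : (J : Set ι).PairwiseDisjoint T) : False := by
  classical
  let S : Finset E := X.filter (· ∈ layer v X k col X.card)
  have hSl : (S : Set E) = layer v X k col X.card := by
    ext g
    simpa [S] using fun hg => layer_subset X.card hg
  let I : ℕ → Finset E := fun i => X.filter (col · = i)
  have hI : ∀ i, (I i : Set E) = ↑X ∩ col ⁻¹' {i} := by
    intro i
    ext g
    simp [I]
  have hIi : ∀ i, 1 ≤ i → linRank v (I i) = (I i).card := fun i hi =>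
    linRank_eq_card (by rw [hI]; exact h.indep i hi)
  -- each class has exactly `linRank v S` elements in the last layer
  have hIS : ∀ i, 1 ≤ i → i ≤ k → linRank v S ≤ (I i ∩ S).card := by
    intro i hi hik
    refine (linRank_mono (A := S) (B := I i ∩ S) ?_).trans (linRank_le_card _)
    intro g hg
    rw [hSl, ← layer_card_succ] at hg
    refine linClosure_mono ?_ (hg.2 i hi hik)
    rw [Finset.coe_inter, hI, hSl]
    exact fun a ha => ⟨⟨layer_subset _ ha.1, ha.2⟩, ha.1⟩
  have hout : ∀ i, 1 ≤ i → i ≤ k → (I i \ S).card + linRank v S ≤ linRank v (I i) := by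
    intro i hi hik
    rw [hIi i hi, ← Finset.card_sdiff_add_card_inter (I i) S]
    exact Nat.add_le_add_left (hIS i hi hik) _
  have hIX : ∀ i, linRank v (I i) ≤ linRank v X := fun i =>
    linRank_mono (fun g hg => subset_linClosure _ (Finset.filter_subset _ _ hg))
  have hIX₀ : linRank v (I i₀) < linRank v X :=
    linRank_lt (Finset.filter_subset _ _) he₀ (by rwa [hI])
  have hTout : ∀ j ∈ J, linRank v X ≤ (T j \ S).card + linRank v S := by
    intro j hj
    calc linRank v X ≤ linRank v (T j) := linRank_mono (hT j hj)
      _ ≤ linRank v ((T j \ S) ∪ S) := linRank_mono (fun g hg => subset_linClosure _ (by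
          by_cases hgS : g ∈ S <;> simp_all))
      _ ≤ linRank v (T j \ S) + linRank v S := linRank_union_le _ _
      _ ≤ _ := Nat.add_le_add_right (linRank_le_card _) _
  have h1 : k * linRank v X ≤ (X \ S).card + k * linRank v S := by
    have hsum : ∑ j ∈ J, (T j \ S).card ≤ (X \ S).card := by
      rw [← Finset.card_biUnion]
      · refine Finset.card_le_card (Finset.biUnion_subset.2 fun j hj => ?_)
        exact Finset.sdiff_subset_sdiff (hTX j hj) subset_rfl
      · exact fun i hi j hj hij => (hd hi hj hij).mono Finset.sdiff_subset Finset.sdiff_subset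
    have := Finset.sum_le_sum hTout
    rw [Finset.sum_add_distrib] at this
    simp only [Finset.sum_const, hJ, smul_eq_mul] at this
    omega
  have h2 : (X \ S).card ≤ ∑ i ∈ Finset.Icc 1 k, (I i \ S).card := by
    refine (Finset.card_le_card fun g hg => ?_).trans Finset.card_biUnion_le
    rw [Finset.mem_sdiff] at hg
    have hg0 : col g ≠ 0 := fun h0 => hg.2 (by simpa [S, hg.1] using hU g hg.1 h0)
    simp only [Finset.mem_biUnion, Finset.mem_Icc, Finset.mem_sdiff]
    exact ⟨col g, ⟨by omega, h.le g hg.1⟩, by simp [I, hg.1], hg.2⟩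
  have h3 : ∑ i ∈ Finset.Icc 1 k, ((I i \ S).card + linRank v S) <
      ∑ i ∈ Finset.Icc 1 k, linRank v X := by
    refine Finset.sum_lt_sum (fun i hi => ?_) ⟨i₀, Finset.mem_Icc.2 ⟨hi₀, hi₀k⟩, ?_⟩
    · rw [Finset.mem_Icc] at hi
      exact (hout i hi.1 hi.2).trans (hIX i)
    · exact (hout i₀ hi₀ hi₀k).trans_lt hIX₀
  rw [Finset.sum_add_distrib] at h3
  simp only [Finset.sum_const, Nat.card_Icc, smul_eq_mul, Nat.add_sub_cancel] at h3
  omega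

end LinearMatroid

/-! ### Connectivity and edge vectors

From here on, the edges of a graph are natural numbers, and the edge `e` has the end points `u e`
and `w e`. -/

section Connectivity

/-- The oriented incidence vector of the edge `e`. -/
noncomputable def edgeVec (u w : ℕ → ℕ) (e : ℕ) : ℕ →₀ ℚ :=
  Finsupp.single (u e) 1 - Finsupp.single (w e) 1

/-- The linear functional that sums the coordinates in `C`. -/
noncomputable def sumOn (C : Set ℕ) : (ℕ →₀ ℚ) →ₗ[ℚ] ℚ :=
  Finsupp.linearCombination ℚ (Set.indicator C 1)

open Classical in
theorem sumOn_single_sub_single (C : Set ℕ) (a b : ℕ) :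
    sumOn C (Finsupp.single a 1 - Finsupp.single b 1) =
      (if a ∈ C then 1 else 0) - (if b ∈ C then 1 else 0) := by
  simp [sumOn, Set.indicator_apply]

theorem sumOn_single_sub_single_eq_zero_iff (C : Set ℕ) (a b : ℕ) :
    sumOn C (Finsupp.single a 1 - Finsupp.single b 1) = 0 ↔ (a ∈ C ↔ b ∈ C) := by
  rw [sumOn_single_sub_single]
  split_ifs <;> simp [*]

variable {u w : ℕ → ℕ} {A C : Set ℕ}

/-- If no edge in `A` leaves `C`, then no edge spanned by `A` does. -/
theorem mem_iff_mem_of_mem_span (h : ∀ g ∈ A, u g ∈ C ↔ w g ∈ C) {a b : ℕ}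
    (hab : Finsupp.single a 1 - Finsupp.single b 1 ∈ Submodule.span ℚ (edgeVec u w '' A)) :
    a ∈ C ↔ b ∈ C := by
  rw [← sumOn_single_sub_single_eq_zero_iff, ← LinearMap.mem_ker]
  refine Submodule.span_le.2 ?_ hab
  rintro _ ⟨g, hg, rfl⟩
  exact (sumOn_single_sub_single_eq_zero_iff C _ _).2 (h g hg)

/-- The set `C`, to which both end points of the edge `g ∈ A` are added if one of them lies
in `C`. -/
def touch (u w : ℕ → ℕ) (A C : Set ℕ) (g : ℕ) : Set ℕ :=
  {x | x ∈ C ∨ (g ∈ A ∧ (u g ∈ C ∨ w g ∈ C)) ∧ (x = u g ∨ x = w g)}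

/-- The effect of touching the edges `0, …, g - 1` in this order. -/
def sweep (u w : ℕ → ℕ) (A C : Set ℕ) : ℕ → Set ℕ
  | 0 => C
  | g + 1 => touch u w A (sweep u w A C g) g

/-- The effect of `r` sweeps over the edges `0, …, m - 1`, started with the set `C`. -/
def sweeps (u w : ℕ → ℕ) (m : ℕ) (A C : Set ℕ) : ℕ → Set ℕ
  | 0 => C
  | r + 1 => sweep u w A (sweeps u w m A C r) m

theorem sweep_mono (C : Set ℕ) : Monotone (sweep u w A C) :=
  monotone_nat_of_le_succ fun _ _ hx => Or.inl hx

theorem sweep_induction {P : ℕ → Prop} (m : ℕ) (hC : ∀ x ∈ C, P x)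
    (hA : ∀ g < m, g ∈ A → (P (u g) ∨ P (w g)) → P (u g) ∧ P (w g)) :
    ∀ x ∈ sweep u w A C m, P x := by
  induction m with
  | zero => exact hC
  | succ g ih =>
    have ih' := ih fun g' hg' => hA g' (by omega)
    rintro x (hx | ⟨⟨hg, h⟩, hx⟩)
    · exact ih' x hx
    · have := hA g (by omega) hg (h.imp (ih' _) (ih' _))
      rcases hx with rfl | rfl
      exacts [this.1, this.2]

theorem sweeps_induction {P : ℕ → Prop} (m r : ℕ) (hC : ∀ x ∈ C, P x)
    (hA : ∀ g < m, g ∈ A → (P (u g) ∨ P (w g)) → P (u g) ∧ P (w g)) :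
    ∀ x ∈ sweeps u w m A C r, P x := by
  induction r with
  | zero => exact hC
  | succ r ih => exact sweep_induction m ih hA

theorem sweep_eq_self_iff {m : ℕ} :
    sweep u w A C m = C ↔ ∀ g < m, g ∈ A → (u g ∈ C ↔ w g ∈ C) := by
  constructor
  · intro h g hg hgA
    have h1 : sweep u w A C g = C :=
      subset_antisymm ((sweep_mono C hg.le).trans h.le) (sweep_mono C (Nat.zero_le g))
    have h2 : touch u w A C g ⊆ C := by
      have := (sweep_mono C (Nat.succ_le_of_lt hg)).trans h.le
      rwa [sweep, h1] at this
    exact ⟨fun hu => h2 (Or.inr ⟨⟨hgA, Or.inl hu⟩, Or.inr rfl⟩),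
      fun hw => h2 (Or.inr ⟨⟨hgA, Or.inr hw⟩, Or.inl rfl⟩)⟩
  · intro h
    refine subset_antisymm (sweep_induction m (fun x hx => hx) fun g hg hgA => ?_)
      (sweep_mono C (Nat.zero_le m))
    have := h g hg hgA
    tauto

/-- The sweeps become stationary, since each one before adds a vertex. -/
theorem sweeps_closed {n m : ℕ} (hnm : n ≤ m + 1) (hu : ∀ g < m, u g < n) (hw : ∀ g < m, w g < n)
    {a : ℕ} (ha : a < n) :
    ∀ g < m, g ∈ A → (u g ∈ sweeps u w m A {a} m ↔ w g ∈ sweeps u w m A {a} m) := by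
  have hsub : ∀ r, sweeps u w m A {a} r ⊆ Set.Iio n := fun r x hx =>
    sweeps_induction (P := (· < n)) m r (by simpa using ha)
      (fun g hg _ _ => ⟨hu g hg, hw g hg⟩) x hx
  have hfin : ∀ r, (sweeps u w m A {a} r).Finite := fun r => (Set.finite_Iio n).subset (hsub r)
  have key : ∀ r, sweep u w A (sweeps u w m A {a} r) m = sweeps u w m A {a} r ∨
      r + 1 ≤ (sweeps u w m A {a} r).ncard := by
    intro r
    induction r with
    | zero => right; simp [sweeps]
    | succ r ih =>
      rcases ih with ih | ih
      · left
        simp only [sweeps, ih]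
      · rcases (sweep_mono (u := u) (w := w) (A := A) (sweeps u w m A {a} r)
          (Nat.zero_le m)).eq_or_lt with h | h
        · left
          have h' : sweep u w A (sweeps u w m A {a} r) m = sweeps u w m A {a} r := h.symm
          simp only [sweeps, h']
        · right
          have := Set.ncard_lt_ncard h (hfin (r + 1))
          simp only [sweep] at this
          rw [sweeps]
          omega
  rcases key m with h | h
  · exact sweep_eq_self_iff.1 h
  · have hall : sweeps u w m A {a} m = Set.Iio n := by
      refine Set.eq_of_subset_of_ncard_le (hsub m) ?_ (Set.finite_Iio n)
      have : (Set.Iio n).ncard = n := by simp [Set.ncard_eq_toFinset_card']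
      omega
    intro g hg _
    rw [hall]
    exact iff_of_true (hu g hg) (hw g hg)

/-- The sweeps decide whether an edge is spanned by `A`. -/
theorem mem_sweeps_iff {n m : ℕ} (hnm : n ≤ m + 1) (hu : ∀ g < m, u g < n)
    (hw : ∀ g < m, w g < n) (hA : A ⊆ Set.Iio m) {e : ℕ} (he : e < m) :
    w e ∈ sweeps u w m A {u e} m ↔ e ∈ linClosure (edgeVec u w) A := by
  constructor
  · refine sweeps_induction (P := fun x => Finsupp.single (u e) 1 - Finsupp.single x 1 ∈
      Submodule.span ℚ (edgeVec u w '' A)) m m (by simp) ?_ (w e)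
    intro g _ hg h
    have hv : edgeVec u w g ∈ Submodule.span ℚ (edgeVec u w '' A) :=
      Submodule.subset_span (Set.mem_image_of_mem _ hg)
    rcases h with h | h
    · refine ⟨h, ?_⟩
      have := add_mem h hv
      simpa [edgeVec] using this
    · refine ⟨?_, h⟩
      have := sub_mem h hv
      simpa [edgeVec] using this
  · intro h
    refine (mem_iff_mem_of_mem_span (fun g hg =>
      sweeps_closed hnm hu hw (hu e he) g (hA hg) hg) h).1 ?_
    have : ∀ r, u e ∈ sweeps u w m A {u e} r := fun r => by
      induction r with
      | zero => rfl
      | succ r ih => exact sweep_mono _ (Nat.zero_le _) ih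
    exact this m

end Connectivity

/-! ### Spanning trees and edge vectors -/

namespace SCGInstance

variable (x : SCGInstance)

/-- The first end point of an edge; zero for numbers that are not edges. -/
def fstEnd (e : ℕ) : ℕ := x.encode.getD (2 + 2 * e) 0

/-- The second end point of an edge; zero for numbers that are not edges. -/
def sndEnd (e : ℕ) : ℕ := x.encode.getD (3 + 2 * e) 0

theorem getD_flatMap_pair {α : Type*} (f g : α → ℕ) (L : List α) {i : ℕ} (hi : i < L.length) :
    (L.flatMap fun q => [f q, g q]).getD (2 * i) 0 = f L[i] ∧
      (L.flatMap fun q => [f q, g q]).getD (2 * i + 1) 0 = g L[i] := by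
  induction L generalizing i with
  | nil => simp at hi
  | cons q L ih =>
    cases i with
    | zero => simp
    | succ i =>
      have := @ih i (by simpa using hi)
      simpa [mul_add, List.getD] using this

theorem fstEnd_coe (e : Fin x.m) : x.fstEnd e = (x.pair e).1 := by
  have := (getD_flatMap_pair (fun q : Fin x.n × Fin x.n => (q.1 : ℕ)) (fun q => (q.2 : ℕ))
    (List.ofFn x.pair) (i := e) (by simp)).1
  rw [fstEnd, encode, show 2 + 2 * (e : ℕ) = 2 * e + 1 + 1 by ring]
  simpa [List.getD] using this

theorem sndEnd_coe (e : Fin x.m) : x.sndEnd e = (x.pair e).2 := by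
  have := (getD_flatMap_pair (fun q : Fin x.n × Fin x.n => (q.1 : ℕ)) (fun q => (q.2 : ℕ))
    (List.ofFn x.pair) (i := e) (by simp)).2
  rw [sndEnd, encode, show 3 + 2 * (e : ℕ) = 2 * e + 1 + 1 + 1 by ring]
  simpa [List.getD] using this

theorem fstEnd_lt {e : ℕ} (he : e < x.m) : x.fstEnd e < x.n := by
  have := x.fstEnd_coe ⟨e, he⟩
  simp only at this
  omega

theorem sndEnd_lt {e : ℕ} (he : e < x.m) : x.sndEnd e < x.n := by
  have := x.sndEnd_coe ⟨e, he⟩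
  simp only at this
  omega

theorem n_le : x.n ≤ x.m + 1 := by
  have h := x.connected.card_vert_le_card_edgeSet_add_one
  rw [SimpleGraph.edgeSet_fromEdgeSet, Nat.card_fin] at h
  have h1 : Nat.card ↑(Set.range (fun e => s((x.pair e).1, (x.pair e).2)) \ Sym2.diagSet) ≤
      (Set.range fun e => s((x.pair e).1, (x.pair e).2)).ncard :=
    Set.ncard_le_ncard Set.sdiff_subset (Set.finite_range _)
  have h2 : (Set.range fun e => s((x.pair e).1, (x.pair e).2)).ncard ≤ x.m := by
    rw [← Set.image_univ]
    refine (Set.ncard_image_le Set.finite_univ).trans ?_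
    simp
  omega

/-- The oriented incidence vectors of the edges. -/
noncomputable abbrev vec : ℕ → ℕ →₀ ℚ := edgeVec x.fstEnd x.sndEnd

theorem single_sub_single_mem_of_ends_eq {A : Set ℕ} {e : Fin x.m} (he : (e : ℕ) ∈ A)
    {a b : Fin x.n} (h : x.ends e = s(a, b)) :
    (Finsupp.single (a : ℕ) 1 - Finsupp.single (b : ℕ) 1 : ℕ →₀ ℚ) ∈
      Submodule.span ℚ (x.vec '' A) := by
  have hv : x.vec e ∈ Submodule.span ℚ (x.vec '' A) :=
    Submodule.subset_span (Set.mem_image_of_mem _ he)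
  rw [vec, edgeVec, fstEnd_coe, sndEnd_coe] at hv
  rcases Sym2.eq_iff.1 h with ⟨h1, h2⟩ | ⟨h1, h2⟩
  · rwa [h1, h2] at hv
  · rw [h1, h2] at hv
    simpa using neg_mem hv

/-- A spanning tree spans all edges. -/
theorem subset_linClosure_of_isSpanningTree {T : Finset (Fin x.m)}
    (hT : IsSpanningTree x.ends T) :
    (Finset.range x.m : Set ℕ) ⊆ linClosure x.vec (T.map Fin.valEmbedding) := by
  have key : ∀ a b : Fin x.n,
      (Finsupp.single (a : ℕ) 1 - Finsupp.single (b : ℕ) 1 : ℕ →₀ ℚ) ∈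
        Submodule.span ℚ (x.vec '' (T.map Fin.valEmbedding)) := by
    intro a b
    obtain ⟨p⟩ := hT.2.2.connected.preconnected a b
    induction p with
    | nil => simp
    | @cons a b c hab p ih =>
      obtain ⟨⟨e, he, hends⟩, -⟩ := (SimpleGraph.fromEdgeSet_adj _).1 hab
      have := add_mem (x.single_sub_single_mem_of_ends_eq
        (A := (T.map Fin.valEmbedding)) (Finset.mem_coe.2 (Finset.mem_map_of_mem _ he)) hends) ih
      simpa using this
  intro e he
  have he' : e < x.m := by simpa using he
  have := key (x.pair ⟨e, he'⟩).1 (x.pair ⟨e, he'⟩).2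
  rwa [← x.fstEnd_coe ⟨e, he'⟩, ← x.sndEnd_coe ⟨e, he'⟩] at this

/-- A set of edges that spans all edges contains a spanning tree. -/
theorem exists_isSpanningTree {A : Set ℕ}
    (h : (Finset.range x.m : Set ℕ) ⊆ linClosure x.vec (↑(Finset.range x.m) ∩ A)) :
    ∃ T : Finset (Fin x.m), (∀ e ∈ T, (e : ℕ) ∈ A) ∧ IsSpanningTree x.ends T := by
  classical
  let B : Set (Fin x.m) := {e | (e : ℕ) ∈ A}
  let H := SimpleGraph.fromEdgeSet (x.ends '' B)
  have hadj : ∀ e ∈ B, H.Reachable (x.pair e).1 (x.pair e).2 := by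
    intro e he
    by_cases heq : (x.pair e).1 = (x.pair e).2
    · rw [heq]
    · exact SimpleGraph.Adj.reachable ((SimpleGraph.fromEdgeSet_adj _).2 ⟨⟨e, he, rfl⟩, heq⟩)
  have hpre : H.Preconnected := by
    intro a b
    -- the component of `a` is left by no edge in `B`, hence by no edge at all
    let C : Set ℕ := {c | ∃ d : Fin x.n, (d : ℕ) = c ∧ H.Reachable a d}
    have hC : ∀ d : Fin x.n, (d : ℕ) ∈ C ↔ H.Reachable a d := fun d =>
      ⟨fun ⟨d', hd, hr⟩ => Fin.ext hd ▸ hr, fun hr => ⟨d, rfl, hr⟩⟩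
    have hcl : ∀ g ∈ (↑(Finset.range x.m) ∩ A : Set ℕ), x.fstEnd g ∈ C ↔ x.sndEnd g ∈ C := by
      rintro g ⟨hg, hgA⟩
      have hg' : g < x.m := by simpa using hg
      have h1 := x.fstEnd_coe ⟨g, hg'⟩
      have h2 := x.sndEnd_coe ⟨g, hg'⟩
      have hr := hadj ⟨g, hg'⟩ hgA
      simp only at h1 h2
      rw [h1, h2, hC, hC]
      exact ⟨fun h => h.trans hr, fun h => h.trans hr.symm⟩
    have hall : ∀ e : Fin x.m, H.Reachable a (x.pair e).1 ↔ H.Reachable a (x.pair e).2 := by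
      intro e
      have := mem_iff_mem_of_mem_span hcl (h (by simp : (e : ℕ) ∈ (Finset.range x.m : Set ℕ)))
      rwa [fstEnd_coe, sndEnd_coe, hC, hC] at this
    obtain ⟨p⟩ := x.connected.preconnected b a
    induction p with
    | nil => exact SimpleGraph.Reachable.refl _
    | @cons b c a hbc p ih =>
      obtain ⟨⟨e, he⟩, -⟩ := (SimpleGraph.fromEdgeSet_adj _).1 hbc
      have hc := ih hC hcl hall
      have := hall e
      rcases Sym2.eq_iff.1 he with ⟨h1, h2⟩ | ⟨h1, h2⟩
      · rw [h1, h2] at this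
        exact this.2 hc
      · rw [h1, h2] at this
        exact this.1 hc
  have hconn : H.Connected := { preconnected := hpre, nonempty := x.connected.nonempty }
  obtain ⟨T, hTH, hT⟩ := hconn.exists_isTree_le
  have hsurj : Set.SurjOn x.ends B T.edgeSet := by
    intro q hq
    have := SimpleGraph.edgeSet_mono hTH hq
    rw [SimpleGraph.edgeSet_fromEdgeSet] at this
    exact this.1
  obtain ⟨B', hB', hbij⟩ := Set.surjOn_iff_exists_bijOn_subset.1 hsurj
  refine ⟨B'.toFinset, fun e he => hB' (by simpa using he), ?_, ?_, ?_⟩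
  · simpa using hbij.injOn
  · intro e he
    exact T.not_isDiag_of_mem_edgeSet (hbij.mapsTo (by simpa using he))
  · rw [Set.coe_toFinset, hbij.image_eq, SimpleGraph.fromEdgeSet_edgeSet]
    exact hT

end SCGInstance

/-! ### A program logic for the random access machine -/

namespace RAM

namespace Store

@[simp] theorem reg_setReg (s : Store) (x c y : ℕ) :
    (s.setReg x c).reg y = if y = x then c else s.reg y := Function.update_apply _ _ _ _

@[simp] theorem arr_setReg (s : Store) (x c : ℕ) : (s.setReg x c).arr = s.arr := rfl

@[simp] theorem reg_setArr (s : Store) (a i c : ℕ) : (s.setArr a i c).reg = s.reg := rfl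

@[simp] theorem arr_setArr (s : Store) (a i c b : ℕ) :
    (s.setArr a i c).arr b = if b = a then Function.update (s.arr a) i c else s.arr b :=
  Function.update_apply _ _ _ _

end Store

namespace Prog

/-- Whether the program contains an assignment to the register `r`. -/
def writesReg : Prog → ℕ → Bool
  | skip, _ => false
  | const x _, r => x == r
  | add x _ _, r => x == r
  | sub x _ _, r => x == r
  | read x _ _, r => x == r
  | write _ _ _, _ => false
  | seq p q, r => p.writesReg r || q.writesReg r
  | ifLt _ _ p q, r => p.writesReg r || q.writesReg r
  | whileLt _ _ p, r => p.writesReg r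

/-- Whether the program contains an assignment to a cell of the array `a`. -/
def writesArr : Prog → ℕ → Bool
  | write b _ _, a => b == a
  | seq p q, a => p.writesArr a || q.writesArr a
  | ifLt _ _ p q, a => p.writesArr a || q.writesArr a
  | whileLt _ _ p, a => p.writesArr a
  | _, _ => false

/-- A bound for the running time of a program in which no loop is iterated more than `B` times. -/
def cost (B : ℕ) : Prog → ℕ
  | seq p q => p.cost B + q.cost B
  | ifLt _ _ p q => p.cost B + q.cost B + 1
  | whileLt _ _ p => B * (p.cost B + 1) + 1
  | _ => 1

theorem cost_mono (p : Prog) {B B' : ℕ} (h : B ≤ B') : p.cost B ≤ p.cost B' := by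
  induction p with
  | seq p q hp hq => exact add_le_add hp hq
  | ifLt x y p q hp hq => exact Nat.succ_le_succ (add_le_add hp hq)
  | whileLt x y p hp =>
    exact Nat.succ_le_succ (Nat.mul_le_mul h (Nat.succ_le_succ hp))
  | _ => exact le_rfl

/-- For a fixed program, the time bound is a polynomial in the bound on the iterations. -/
theorem exists_polynomial_cost (p : Prog) : ∃ f : Polynomial ℕ, ∀ B, p.cost B = f.eval B := by
  induction p with
  | seq p q hp hq =>
    obtain ⟨f, hf⟩ := hp
    obtain ⟨g, hg⟩ := hq
    exact ⟨f + g, fun B => by simp [cost, hf, hg]⟩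
  | ifLt x y p q hp hq =>
    obtain ⟨f, hf⟩ := hp
    obtain ⟨g, hg⟩ := hq
    exact ⟨f + g + 1, fun B => by simp [cost, hf, hg]⟩
  | whileLt x y p hp =>
    obtain ⟨f, hf⟩ := hp
    exact ⟨Polynomial.X * (f + 1) + 1, fun B => by simp [cost, hf]⟩
  | _ => exact ⟨1, fun B => by simp [cost]⟩

end Prog

/-- The registers and arrays to which `p` contains no assignment agree in `s` and `s'`. -/
structure Frame (p : Prog) (s s' : Store) : Prop where
  reg : ∀ r, p.writesReg r = false → s'.reg r = s.reg r
  arr : ∀ a, p.writesArr a = false → s'.arr a = s.arr a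

theorem Frame.refl (p : Prog) (s : Store) : Frame p s s := ⟨fun _ _ => rfl, fun _ _ => rfl⟩

theorem Frame.trans {p : Prog} {s s' s'' : Store} (h : Frame p s s') (h' : Frame p s' s'') :
    Frame p s s'' :=
  ⟨fun r hr => (h'.reg r hr).trans (h.reg r hr), fun a ha => (h'.arr a ha).trans (h.arr a ha)⟩

theorem Frame.mono {p q : Prog} {s s' : Store} (h : Frame p s s')
    (hr : ∀ r, q.writesReg r = false → p.writesReg r = false)
    (ha : ∀ a, q.writesArr a = false → p.writesArr a = false) : Frame q s s' :=
  ⟨fun r h' => h.reg r (hr r h'), fun a h' => h.arr a (ha a h')⟩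

/-- `wp B p Q s`: started in `s`, the program `p` halts in a store with the property `Q`, and no
loop is iterated more than `B` times each time it is entered. For a loop this is witnessed by an
invariant `I j`, where `j ≤ B` bounds the number of the remaining iterations. -/
def wp (B : ℕ) : Prog → (Store → Prop) → Store → Prop
  | .skip, Q, s => Q s
  | .const x c, Q, s => Q (s.setReg x c)
  | .add x y z, Q, s => Q (s.setReg x (s.reg y + s.reg z))
  | .sub x y z, Q, s => Q (s.setReg x (s.reg y - s.reg z))
  | .read x a y, Q, s => Q (s.setReg x (s.arr a (s.reg y)))
  | .write a x y, Q, s => Q (s.setArr a (s.reg x) (s.reg y))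
  | .seq p q, Q, s => wp B p (wp B q Q) s
  | .ifLt x y p q, Q, s =>
      (s.reg x < s.reg y → wp B p Q s) ∧ (¬ s.reg x < s.reg y → wp B q Q s)
  | .whileLt x y p, Q, s => ∃ I : ℕ → Store → Prop, (∃ j ≤ B, I j s) ∧
      (∀ j s, I j s → s.reg x < s.reg y → wp B p (fun s' => ∃ j' < j, I j' s') s) ∧
      (∀ j s, I j s → ¬ s.reg x < s.reg y → Q s)

variable {B : ℕ}

/-- Soundness of the program logic, with a bound on the running time. -/
theorem exists_exec_of_wp {p : Prog} {Q : Store → Prop} {s : Store} (h : wp B p Q s) :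
    ∃ t s', Exec p s t s' ∧ t ≤ p.cost B ∧ Q s' := by
  induction p generalizing Q s with
  | skip => exact ⟨_, _, .skip s, le_rfl, h⟩
  | const x c => exact ⟨_, _, .const x c s, le_rfl, h⟩
  | add x y z => exact ⟨_, _, .add x y z s, le_rfl, h⟩
  | sub x y z => exact ⟨_, _, .sub x y z s, le_rfl, h⟩
  | read x a y => exact ⟨_, _, .read x a y s, le_rfl, h⟩
  | write a x y => exact ⟨_, _, .write a x y s, le_rfl, h⟩
  | seq p q hp hq =>
    obtain ⟨t, s', h₁, ht, h'⟩ := hp h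
    obtain ⟨t', s'', h₂, ht', hQ⟩ := hq h'
    exact ⟨_, _, .seq h₁ h₂, add_le_add ht ht', hQ⟩
  | ifLt x y p q hp hq =>
    by_cases hlt : s.reg x < s.reg y
    · obtain ⟨t, s', h₁, ht, hQ⟩ := hp (h.1 hlt)
      exact ⟨_, _, .ifTrue hlt h₁, by simp only [Prog.cost]; omega, hQ⟩
    · obtain ⟨t, s', h₁, ht, hQ⟩ := hq (h.2 hlt)
      exact ⟨_, _, .ifFalse hlt h₁, by simp only [Prog.cost]; omega, hQ⟩
  | whileLt x y p hp =>
    obtain ⟨I, ⟨j, hj, hI⟩, hstep, hexit⟩ := h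
    suffices ∃ t s', Exec (.whileLt x y p) s t s' ∧ t ≤ j * (p.cost B + 1) + 1 ∧ Q s' by
      obtain ⟨t, s', h₁, ht, hQ⟩ := this
      exact ⟨t, s', h₁, ht.trans (Nat.succ_le_succ (Nat.mul_le_mul_right _ hj)), hQ⟩
    clear hj
    induction j using Nat.strong_induction_on generalizing s with
    | _ j ih =>
      by_cases hlt : s.reg x < s.reg y
      · obtain ⟨t, s', h₁, ht, j', hj', hI'⟩ := hp (hstep j s hI hlt)
        obtain ⟨t', s'', h₂, ht', hQ⟩ := ih j' hj' hI'
        refine ⟨_, _, .whileTrue hlt h₁ h₂, ?_, hQ⟩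
        have := Nat.mul_le_mul_right (p.cost B + 1) (Nat.succ_le_of_lt hj')
        rw [Nat.succ_mul] at this
        omega
      · exact ⟨_, _, .whileFalse hlt, by omega, hexit j s hI hlt⟩

/-- The rule of consequence, in which the unchanged part of the store need not be mentioned. -/
theorem wp_conseq {p : Prog} {Q Q' : Store → Prop} {s : Store} (h : wp B p Q s)
    (hQ : ∀ s', Frame p s s' → Q s' → Q' s') : wp B p Q' s := by
  induction p generalizing Q Q' s with
  | skip => exact hQ _ (Frame.refl _ _) h
  | write a x y =>
    refine hQ _ ⟨fun _ _ => rfl, fun b hb => ?_⟩ h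
    have : b ≠ a := by rintro rfl; simp [Prog.writesArr] at hb
    simp [this]
  | seq p q hp hq =>
    refine hp h fun s' hF h' => hq h' fun s'' hF' h'' => hQ s'' ?_ h''
    exact (hF.mono (by simp_all [Prog.writesReg]) (by simp_all [Prog.writesArr])).trans
      (hF'.mono (by simp_all [Prog.writesReg]) (by simp_all [Prog.writesArr]))
  | ifLt x y p q hp hq =>
    refine ⟨fun hlt => hp (h.1 hlt) fun s' hF => hQ s' ?_,
      fun hlt => hq (h.2 hlt) fun s' hF => hQ s' ?_⟩ <;>
    exact hF.mono (by simp_all [Prog.writesReg]) (by simp_all [Prog.writesArr])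
  | whileLt x y p hp =>
    obtain ⟨I, ⟨j, hj, hI⟩, hstep, hexit⟩ := h
    refine ⟨fun j s' => I j s' ∧ Frame (.whileLt x y p) s s', ⟨j, hj, hI, Frame.refl _ _⟩, ?_, ?_⟩
    · rintro j s' ⟨hI, hF⟩ hlt
      refine hp (hstep j s' hI hlt) ?_
      rintro s'' hF' ⟨j', hj', hI'⟩
      exact ⟨j', hj', hI', hF.trans (hF'.mono (fun _ => id) (fun _ => id))⟩
    · rintro j s' ⟨hI, hF⟩ hlt
      exact hQ s' hF (hexit j s' hI hlt)
  | _ =>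
    refine hQ _ ⟨fun r hr => ?_, fun _ _ => rfl⟩ h
    simp only [Prog.writesReg, beq_eq_false_iff_ne] at hr
    simp [hr.symm]

infixr:60 " ;; " => Prog.seq

/-- The loop `for x := 0, …, y - 1 do p`. Register `6` is supposed to contain the number `1`. -/
def forLt (x y : ℕ) (p : Prog) : Prog := .const x 0 ;; .whileLt x y (p ;; .add x x 6)

/-- The rule for bounded loops. -/
theorem wp_forLt {x y : ℕ} {p : Prog} {Q : Store → Prop} {s : Store} (N : ℕ) (hN : s.reg y = N)
    (hNB : N ≤ B) (h6 : s.reg 6 = 1) (hx : p.writesReg x = false) (hy : p.writesReg y = false)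
    (hp6 : p.writesReg 6 = false) (hxy : y ≠ x) (hx6 : x ≠ 6) (I : ℕ → Store → Prop)
    (h0 : I 0 (s.setReg x 0))
    (hstep : ∀ i < N, ∀ s', Frame (forLt x y p) s s' → s'.reg x = i → I i s' →
      wp B p (fun s'' => I (i + 1) (s''.setReg x (i + 1))) s')
    (hQ : ∀ s', Frame (forLt x y p) s s' → I N s' → Q s') : wp B (forLt x y p) Q s := by
  have hF0 : Frame (forLt x y p) s (s.setReg x 0) := by
    refine ⟨fun r hr => ?_, fun _ _ => rfl⟩
    have : x ≠ r := by rintro rfl; simp [forLt, Prog.writesReg] at hr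
    simp [this.symm]
  have hFp : ∀ {s' s''}, Frame p s' s'' → Frame (forLt x y p) s' s'' := fun hF =>
    hF.mono (by simp +contextual [forLt, Prog.writesReg])
      (by simp +contextual [forLt, Prog.writesArr])
  have hFx : ∀ {s'} c, Frame (forLt x y p) s' (Store.setReg s' x c) := by
    intro s' c
    refine ⟨fun r hr => ?_, fun _ _ => rfl⟩
    have : x ≠ r := by rintro rfl; simp [forLt, Prog.writesReg] at hr
    simp [this.symm]
  show wp B (.whileLt x y (p ;; .add x x 6)) Q (s.setReg x 0)
  refine ⟨fun j s' => ∃ i ≤ N, j = N - i ∧ Frame (forLt x y p) s s' ∧ s'.reg x = i ∧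
    s'.reg y = N ∧ s'.reg 6 = 1 ∧ I i s', ⟨N, hNB, 0, Nat.zero_le _, rfl, hF0, by simp,
      by simpa [hxy], by simpa [hx6.symm], h0⟩, ?_, ?_⟩
  · rintro j s' ⟨i, hi, rfl, hF, hsx, hsy, hs6, hI⟩ hlt
    rw [hsx, hsy] at hlt
    show wp B p (wp B (.add x x 6) _) s'
    refine wp_conseq (hstep i hlt s' hF hsx hI) ?_
    intro s'' hF' hI'
    show ∃ _, _
    have h1 : s''.reg x = i := (hF'.reg x hx).trans hsx
    have h2 : s''.reg y = N := (hF'.reg y hy).trans hsy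
    have h3 : s''.reg 6 = 1 := (hF'.reg 6 hp6).trans hs6
    rw [h1, h3]
    refine ⟨N - (i + 1), by omega, i + 1, hlt, rfl, ?_, by simp, by simpa [hxy],
      by simpa [hx6.symm], hI'⟩
    exact (hF.trans (hFp hF')).trans (hFx _)
  · rintro j s' ⟨i, hi, rfl, hF, hsx, hsy, hs6, hI⟩ hlt
    rw [hsx, hsy] at hlt
    obtain rfl : i = N := by omega
    exact hQ s' hF hI

/-! ### The program for the connectivity test

Registers `2` to `7` hold the number of vertices, the number of edges, the number of colours, the
flag of the main loop, and the numbers `1` and `0`. Arrays `2` to `6` hold the colours and the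
levels of the edges, the marks of the vertices, and the first and second end points of the edges. -/

/-- The registers and arrays that represent the graph have the intended contents. -/
structure HoldsGraph (n m : ℕ) (u w : ℕ → ℕ) (s : Store) : Prop where
  reg_n : s.reg 2 = n
  reg_m : s.reg 3 = m
  reg_one : s.reg 6 = 1
  reg_zero : s.reg 7 = 0
  arr_u : ∀ e < m, s.arr 5 e = u e
  arr_w : ∀ e < m, s.arr 6 e = w e

/-- The program does not overwrite the representation of the graph. -/
def keepsGraph (p : Prog) : Bool :=
  !(p.writesReg 2 || p.writesReg 3 || p.writesReg 6 || p.writesReg 7 ||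
    p.writesArr 5 || p.writesArr 6)

variable {n m : ℕ} {u w : ℕ → ℕ}

theorem HoldsGraph.of_frame {s s' : Store} {p : Prog} (h : HoldsGraph n m u w s)
    (hF : Frame p s s') (hp : keepsGraph p = true) : HoldsGraph n m u w s' := by
  simp only [keepsGraph, Bool.not_eq_true', Bool.or_eq_false_iff] at hp
  obtain ⟨⟨⟨⟨⟨h2, h3⟩, h6⟩, h7⟩, h5⟩, h6'⟩ := hp
  constructor
  · rw [hF.reg 2 h2, h.reg_n]
  · rw [hF.reg 3 h3, h.reg_m]
  · rw [hF.reg 6 h6, h.reg_one]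
  · rw [hF.reg 7 h7, h.reg_zero]
  · rw [hF.arr 5 h5]; exact h.arr_u
  · rw [hF.arr 6 h6']; exact h.arr_w

/-- What is assumed of the graph: the end points are vertices, there are enough edges for the
sweeps to become stationary, and loops over vertices or edges respect the bound `B`. -/
structure GraphBounds (B n m : ℕ) (u w : ℕ → ℕ) : Prop where
  n_le : n ≤ m + 1
  u_lt : ∀ e < m, u e < n
  w_lt : ∀ e < m, w e < n
  le_bound : m + 1 ≤ B

/-- The edges whose colour is `c` and whose level is at least `t`. -/
def colorLevel (m : ℕ) (s : Store) (c t : ℕ) : Set ℕ := {g | g < m ∧ s.arr 2 g = c ∧ t ≤ s.arr 3 g}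

/-- Mark both end points of the edge in register `14` if one of them is marked, provided that the
edge has the colour in register `8` and at least the level in register `9`. -/
def touchProg : Prog :=
  .read 15 2 14 ;; .read 16 3 14 ;;
  .ifLt 15 8 .skip (.ifLt 8 15 .skip (.ifLt 16 9 .skip (
    .read 17 5 14 ;; .read 18 6 14 ;; .read 15 4 17 ;; .read 16 4 18 ;; .add 15 15 16 ;;
    .ifLt 7 15 (.write 4 17 6 ;; .write 4 18 6) .skip)))

/-- Set register `11` to a nonzero value iff the edge in register `10` is spanned by the edges
that have the colour in register `8` and at least the level in register `9`. -/
def connProg : Prog :=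
  forLt 12 2 (.write 4 12 7) ;;
  .read 17 5 10 ;; .write 4 17 6 ;;
  forLt 13 3 (forLt 14 3 touchProg) ;;
  .read 18 6 10 ;; .read 11 4 18

theorem wp_touchProg {C : Set ℕ} {s : Store} (hG : GraphBounds B n m u w)
    (hs : HoldsGraph n m u w s) (hg : s.reg 14 < m) (hC : ∀ x < n, s.arr 4 x ≠ 0 ↔ x ∈ C) :
    wp B touchProg (fun s' => ∀ x < n, s'.arr 4 x ≠ 0 ↔
      x ∈ touch u w (colorLevel m s (s.reg 8) (s.reg 9)) C (s.reg 14)) s := by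
  have hu := hC _ (hG.u_lt _ hg)
  have hw := hC _ (hG.w_lt _ hg)
  have hmem : s.reg 14 ∈ colorLevel m s (s.reg 8) (s.reg 9) ↔
      s.arr 2 (s.reg 14) = s.reg 8 ∧ s.reg 9 ≤ s.arr 3 (s.reg 14) := by
    simp [colorLevel, hg]
  simp only [touch, Set.mem_ofPred_eq, hmem]
  simp only [touchProg, wp, Store.reg_setReg, Store.arr_setReg, Store.reg_setArr, Store.arr_setArr,
    Nat.reduceEqDiff, if_true, if_false, hs.reg_zero, hs.reg_one, hs.arr_u _ hg, hs.arr_w _ hg]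
  refine ⟨fun h x hx => ?_, fun h1 => ⟨fun h x hx => ?_, fun h2 => ⟨fun h x hx => ?_,
    fun h3 => ⟨fun h x hx => ?_, fun h x hx => ?_⟩⟩⟩⟩
  · rw [hC x hx]; have : ¬ s.arr 2 (s.reg 14) = s.reg 8 := by omega
    tauto
  · rw [hC x hx]; have : ¬ s.arr 2 (s.reg 14) = s.reg 8 := by omega
    tauto
  · rw [hC x hx]; have : ¬ s.reg 9 ≤ s.arr 3 (s.reg 14) := by omega
    tauto
  · have h4 : s.arr 2 (s.reg 14) = s.reg 8 := by omega
    have h5 : s.reg 9 ≤ s.arr 3 (s.reg 14) := by omega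
    have h6 : u (s.reg 14) ∈ C ∨ w (s.reg 14) ∈ C := by rw [← hu, ← hw]; omega
    have := hC x hx
    simp only [Function.update_apply]
    split_ifs <;> simp_all
  · have h6 : ¬ (u (s.reg 14) ∈ C ∨ w (s.reg 14) ∈ C) := by rw [← hu, ← hw]; omega
    rw [hC x hx]
    tauto

theorem wp_connProg {s : Store} (hG : GraphBounds B n m u w) (hs : HoldsGraph n m u w s)
    (he : s.reg 10 < m) :
    wp B connProg (fun s' => s'.reg 11 ≠ 0 ↔
      s.reg 10 ∈ linClosure (edgeVec u w) (colorLevel m s (s.reg 8) (s.reg 9))) s := by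
  have hmB : m ≤ B := by have := hG.le_bound; omega
  have hnB : n ≤ B := hG.n_le.trans hG.le_bound
  set A := colorLevel m s (s.reg 8) (s.reg 9) with hA
  set e := s.reg 10 with he'
  show wp B (forLt 12 2 (.write 4 12 7)) _ s
  refine wp_forLt n hs.reg_n hnB hs.reg_one rfl rfl rfl (by decide) (by decide)
    (fun i s' => ∀ x < i, s'.arr 4 x = 0) (by simp) ?_ ?_
  · intro i hi s' hF hsi hI x hx
    simp only [Store.arr_setReg, Store.arr_setArr, if_true, (hs.of_frame hF rfl).reg_zero, hsi,
      Function.update_apply]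
    split_ifs
    · rfl
    · exact hI x (by omega)
  intro s₁ hF₁ hI₁
  have hs₁ := hs.of_frame hF₁ rfl
  have h10 : s₁.reg 10 = e := hF₁.reg 10 rfl
  show wp B (forLt 13 3 (forLt 14 3 touchProg)) _ _
  set s₂ : Store := (s₁.setReg 17 (s₁.arr 5 (s₁.reg 10))).setArr 4
    ((s₁.setReg 17 (s₁.arr 5 (s₁.reg 10))).reg 17)
    ((s₁.setReg 17 (s₁.arr 5 (s₁.reg 10))).reg 6) with hs₂'
  have hF₂ : Frame connProg s₁ s₂ := by
    refine ⟨fun r hr => ?_, fun a ha => ?_⟩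
    · have : r ≠ 17 := by rintro rfl; simp [connProg, Prog.writesReg] at hr
      simp [hs₂', this]
    · have : a ≠ 4 := by rintro rfl; simp [connProg, Prog.writesArr] at ha
      simp [hs₂', this]
  have hF₂' : Frame connProg s s₂ :=
    (hF₁.mono (by simp +contextual [connProg, Prog.writesReg])
      (by simp +contextual [connProg, Prog.writesArr])).trans hF₂
  have hs₂ := hs₁.of_frame hF₂ rfl
  have hmark : ∀ x < n, s₂.arr 4 x ≠ 0 ↔ x ∈ ({u e} : Set ℕ) := by
    intro x hx
    simp only [hs₂', Store.arr_setArr, Store.reg_setReg, Store.arr_setReg, if_true,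
      Nat.reduceEqDiff, if_false, h10, hs₁.arr_u e he, hs₁.reg_one, Function.update_apply,
      Set.mem_singleton_iff]
    split_ifs with h
    · simp [h]
    · simp [h, hI₁ x hx]
  refine wp_forLt m hs₂.reg_m hmB hs₂.reg_one rfl rfl rfl (by decide) (by decide)
    (fun r s' => ∀ x < n, s'.arr 4 x ≠ 0 ↔ x ∈ sweeps u w m A {u e} r) hmark ?_ ?_
  · intro r hr s' hF hsr hI
    have hs' := hs₂.of_frame hF rfl
    refine wp_forLt m hs'.reg_m hmB hs'.reg_one rfl rfl rfl (by decide) (by decide)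
      (fun g s' => ∀ x < n, s'.arr 4 x ≠ 0 ↔ x ∈ sweep u w A (sweeps u w m A {u e} r) g) hI ?_ ?_
    · intro g hg s'' hF' hsg hI'
      have hs'' := hs'.of_frame hF' rfl
      have hreg : ∀ q, connProg.writesReg q = false → s''.reg q = s.reg q := fun q hq => by
        have h1 : (forLt 13 3 (forLt 14 3 touchProg)).writesReg q = false := by
          simp only [connProg, Prog.writesReg, Bool.or_eq_false_iff] at hq
          exact hq.2.2.2.1
        have h2 : (forLt 14 3 touchProg).writesReg q = false := by
          rw [forLt] at h1
          simp only [Prog.writesReg, Bool.or_eq_false_iff] at h1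
          exact h1.2.1
        rw [hF'.reg q h2, hF.reg q h1, hF₂'.reg q hq]
      have hAeq : colorLevel m s'' (s''.reg 8) (s''.reg 9) = A := by
        rw [hreg 8 rfl, hreg 9 rfl, hA]
        unfold colorLevel
        rw [hF'.arr 2 rfl, hF'.arr 3 rfl, hF.arr 2 rfl, hF.arr 3 rfl, hF₂'.arr 2 rfl,
          hF₂'.arr 3 rfl]
      refine wp_conseq (wp_touchProg hG hs'' (hsg ▸ hg) hI') fun s₃ _ h x hx => ?_
      rw [hAeq, hsg] at h
      exact h x hx
    · intro s'' _ hI'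
      exact hI'
  · intro s₃ hF₃ hI₃
    have hs₃ := hs₂.of_frame hF₃ rfl
    have h10' : s₃.reg 10 = e := (hF₃.reg 10 rfl).trans ((hF₂.reg 10 rfl).trans h10)
    simp only [wp, Store.reg_setReg, Store.arr_setReg, if_true, h10', hs₃.arr_w e he]
    rw [hI₃ _ (hG.w_lt e he)]
    exact mem_sweeps_iff hG.n_le hG.u_lt hG.w_lt (fun g hg => hg.1) he

/-! ### The programs for the layers -/

/-- Set register `21` to a colour that, within the edges of at least the level in register `9`,
does not span the edge in register `10`, or to `0` if there is none. -/
def spanProg : Prog :=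
  .const 21 0 ;; forLt 20 4 (.add 8 20 6 ;; connProg ;; .ifLt 7 11 .skip (.add 21 8 7))

theorem wp_spanProg {s : Store} {k : ℕ} (hG : GraphBounds B n m u w) (hs : HoldsGraph n m u w s)
    (hk : s.reg 4 = k) (hkB : k ≤ B) (he : s.reg 10 < m) :
    wp B spanProg (fun s' =>
      (s'.reg 21 = 0 ∧ ∀ i, 1 ≤ i → i ≤ k →
        s.reg 10 ∈ linClosure (edgeVec u w) (colorLevel m s i (s.reg 9))) ∨
      (1 ≤ s'.reg 21 ∧ s'.reg 21 ≤ k ∧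
        s.reg 10 ∉ linClosure (edgeVec u w) (colorLevel m s (s'.reg 21) (s.reg 9)))) s := by
  show wp B (forLt 20 4 _) _ (s.setReg 21 0)
  set s₁ := s.setReg 21 0 with hs₁'
  have hF₁ : Frame spanProg s s₁ := by
    refine ⟨fun r hr => ?_, fun a ha => rfl⟩
    have : r ≠ 21 := by rintro rfl; simp [spanProg, Prog.writesReg] at hr
    simp [hs₁', this]
  have hs₁ : HoldsGraph n m u w s₁ := hs.of_frame hF₁ rfl
  refine wp_forLt k ((hF₁.reg 4 rfl).trans hk) hkB hs₁.reg_one rfl rfl rfl (by decide) (by decide)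
    (fun j s' => (s'.reg 21 = 0 ∧ ∀ i, 1 ≤ i → i ≤ j →
        s.reg 10 ∈ linClosure (edgeVec u w) (colorLevel m s i (s.reg 9))) ∨
      (1 ≤ s'.reg 21 ∧ s'.reg 21 ≤ k ∧
        s.reg 10 ∉ linClosure (edgeVec u w) (colorLevel m s (s'.reg 21) (s.reg 9)))) ?_ ?_ ?_
  · exact Or.inl ⟨by simp [hs₁'], fun i h1 h0 => by omega⟩
  · intro j hj s₂ hF₂ hsj hI
    have hs₂ := hs₁.of_frame hF₂ rfl
    show wp B connProg _ _
    rw [hsj, hs₂.reg_one]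
    have hs₃ : HoldsGraph n m u w (s₂.setReg 8 (j + 1)) :=
      ⟨by simp [hs₂.reg_n], by simp [hs₂.reg_m], by simp [hs₂.reg_one], by simp [hs₂.reg_zero],
        hs₂.arr_u, hs₂.arr_w⟩
    have h9 : s₂.reg 9 = s.reg 9 := (hF₂.reg 9 rfl).trans (hF₁.reg 9 rfl)
    have h10 : s₂.reg 10 = s.reg 10 := (hF₂.reg 10 rfl).trans (hF₁.reg 10 rfl)
    have hcl : ∀ c t, colorLevel m s₂ c t = colorLevel m s c t := fun c t => by
      unfold colorLevel
      rw [hF₂.arr 2 rfl, hF₂.arr 3 rfl, hF₁.arr 2 rfl, hF₁.arr 3 rfl]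
    refine wp_conseq (wp_connProg hG hs₃ (by simpa [h10] using he)) fun s₄ hF₄ h => ?_
    have hs₄ := hs₃.of_frame hF₄ rfl
    have h8 : s₄.reg 8 = j + 1 := by rw [hF₄.reg 8 rfl]; simp
    have h21 : s₄.reg 21 = s₂.reg 21 := by rw [hF₄.reg 21 rfl]; simp
    replace h : s₄.reg 11 ≠ 0 ↔
        s.reg 10 ∈ linClosure (edgeVec u w) (colorLevel m s (j + 1) (s.reg 9)) := by
      simp only [Store.reg_setReg, if_true, Nat.reduceEqDiff, if_false, h9, h10] at h
      rw [← hcl]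
      exact h
    refine ⟨fun hlt => ?_, fun hlt => ?_⟩
    · rw [hs₄.reg_zero] at hlt
      show _ ∨ _
      simp only [Store.reg_setReg, Nat.reduceEqDiff, if_false, h21]
      refine hI.imp (fun hI => ⟨hI.1, fun i h1 h2 => ?_⟩) id
      rcases h2.eq_or_lt with rfl | h2
      · exact h.1 (by omega)
      · exact hI.2 i h1 (by omega)
    · rw [hs₄.reg_zero] at hlt
      right
      simp only [Store.reg_setReg, Nat.reduceEqDiff, if_false, if_true, h8, hs₄.reg_zero]
      exact ⟨by omega, by omega, fun hcon => hlt (by have := h.2 hcon; omega)⟩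
  · intro s' _ h
    exact h

/-- Fill array `3` with the levels of the edges. -/
def levelProg : Prog :=
  forLt 10 3 (.write 3 10 7) ;;
  forLt 9 3 (forLt 10 3 (
    .read 22 3 10 ;;
    .ifLt 22 9 .skip (spanProg ;; .ifLt 21 6 (.add 22 9 6 ;; .write 3 10 22) .skip)))

theorem colorLevel_eq_layer_inter {k t : ℕ} {s : Store} {col : ℕ → ℕ} (hcol : s.arr 2 = col)
    (h : ∀ g < m, t ≤ s.arr 3 g ↔ g ∈ layer (edgeVec u w) (Finset.range m) k col t) (i : ℕ) :
    colorLevel m s i t = layer (edgeVec u w) (Finset.range m) k col t ∩ col ⁻¹' {i} := by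
  subst hcol
  ext g
  simp only [colorLevel, Set.mem_ofPred_eq, Set.mem_inter_iff, Set.mem_preimage,
    Set.mem_singleton_iff]
  constructor
  · rintro ⟨hg, hc, ht⟩
    exact ⟨(h g hg).1 ht, hc⟩
  · rintro ⟨hl, hc⟩
    have hg : g < m := by simpa using layer_subset t hl
    exact ⟨hg, hc, (h g hg).2 hl⟩

theorem wp_levelProg {s : Store} {k : ℕ} (hG : GraphBounds B n m u w) (hs : HoldsGraph n m u w s)
    (hk : s.reg 4 = k) (hkB : k ≤ B) :
    wp B levelProg (fun s' => ∀ e < m,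
      s'.arr 3 e = level (edgeVec u w) (Finset.range m) k (s.arr 2) m e) s := by
  classical
  set lv := level (edgeVec u w) (Finset.range m) k (s.arr 2) with hlv
  have hmB : m ≤ B := by have := hG.le_bound; omega
  show wp B (forLt 10 3 _) _ s
  refine wp_forLt m hs.reg_m hmB hs.reg_one rfl rfl rfl (by decide) (by decide)
    (fun i s' => ∀ e < i, s'.arr 3 e = 0) (by simp) ?_ ?_
  · intro i hi s' hF hsi hI e he
    simp only [Store.arr_setReg, Store.arr_setArr, if_true, (hs.of_frame hF rfl).reg_zero, hsi,
      Function.update_apply]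
    split_ifs
    · rfl
    · exact hI e (by omega)
  intro s₁ hF₁ hI₁
  have hs₁ := hs.of_frame hF₁ rfl
  show wp B (forLt 9 3 _) _ s₁
  refine wp_forLt m hs₁.reg_m hmB hs₁.reg_one rfl rfl rfl (by decide) (by decide)
    (fun t s' => ∀ e < m, s'.arr 3 e = lv t e) hI₁ ?_ (fun _ _ h => h)
  intro t ht s₂ hF₂ hst hI₂
  have hs₂ := hs₁.of_frame hF₂ rfl
  refine wp_forLt m hs₂.reg_m hmB hs₂.reg_one rfl rfl rfl (by decide) (by decide)
    (fun i s' => ∀ e < m, s'.arr 3 e = if e < i then lv (t + 1) e else lv t e)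
    (by simpa using hI₂) ?_ ?_
  · intro e he s₃ hF₃ hse hI₃
    have hs₃ := hs₂.of_frame hF₃ rfl
    have hcol : s₃.arr 2 = s.arr 2 := by rw [hF₃.arr 2 rfl, hF₂.arr 2 rfl, hF₁.arr 2 rfl]
    have h4 : s₃.reg 4 = k := by rw [hF₃.reg 4 rfl, hF₂.reg 4 rfl, hF₁.reg 4 rfl, hk]
    have h9 : s₃.reg 9 = t := by rw [hF₃.reg 9 rfl, hst]
    have hlay : ∀ g < m, t ≤ s₃.arr 3 g ↔
        g ∈ layer (edgeVec u w) (Finset.range m) k (s.arr 2) t := by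
      intro g hg
      rw [hI₃ g hg]
      split_ifs
      · exact le_level_iff (Nat.le_succ t) (by simpa using hg)
      · exact le_level_iff le_rfl (by simpa using hg)
    have hlev : lv (t + 1) e = if e ∈ layer (edgeVec u w) (Finset.range m) k (s.arr 2) (t + 1)
        then t + 1 else lv t e := rfl
    have hkeep : e ∉ layer (edgeVec u w) (Finset.range m) k (s.arr 2) (t + 1) →
        ∀ g < m, s₃.arr 3 g = if g < e + 1 then lv (t + 1) g else lv t g := by
      intro hn g hg
      rw [hI₃ g hg]
      rcases lt_trichotomy g e with h | rfl | h
      · simp [h, Nat.lt_succ_of_lt h]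
      · simp [hlev, hn]
      · simp [show ¬ g < e by omega, show ¬ g < e + 1 by omega]
    show wp B (.ifLt 22 9 .skip _) _ (s₃.setReg 22 (s₃.arr 3 (s₃.reg 10)))
    rw [hse]
    refine ⟨fun hlt => ?_, fun hlt => ?_⟩
    · simp only [Store.reg_setReg, if_true, Nat.reduceEqDiff, if_false, h9] at hlt
      refine hkeep fun hcon => ?_
      have := (hlay e he).2 (layer_succ_subset t hcon)
      omega
    · simp only [Store.reg_setReg, if_true, Nat.reduceEqDiff, if_false, h9] at hlt
      have het := (hlay e he).1 (by omega)
      set s₄ := s₃.setReg 22 (s₃.arr 3 e) with hs₄'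
      have hs₄ : HoldsGraph n m u w s₄ :=
        ⟨by simp [hs₄', hs₃.reg_n], by simp [hs₄', hs₃.reg_m], by simp [hs₄', hs₃.reg_one],
          by simp [hs₄', hs₃.reg_zero], hs₃.arr_u, hs₃.arr_w⟩
      have h9' : s₄.reg 9 = t := by simp [hs₄', h9]
      have h10' : s₄.reg 10 = e := by simp [hs₄', hse]
      show wp B spanProg _ s₄
      refine wp_conseq
        (wp_spanProg (k := k) hG hs₄ (by simp [hs₄', h4]) hkB (by rw [h10']; exact he))
        fun s₅ hF₅ h => ?_
      have hs₅ := hs₄.of_frame hF₅ rfl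
      have harr : s₅.arr 3 = s₃.arr 3 := by rw [hF₅.arr 3 rfl]; rfl
      simp only [h9', h10', colorLevel_eq_layer_inter (s := s₄) (t := t) hcol hlay] at h
      refine ⟨fun hlt' => ?_, fun hlt' => ?_⟩
      · rw [hs₅.reg_one] at hlt'
        have hmem : e ∈ layer (edgeVec u w) (Finset.range m) k (s.arr 2) (t + 1) := by
          rcases h with h | h
          · exact ⟨het, h.2⟩
          · omega
        have h9'' : s₅.reg 9 = t := by rw [hF₅.reg 9 rfl, h9']
        have h10'' : s₅.reg 10 = e := by rw [hF₅.reg 10 rfl, h10']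
        intro g hg
        simp only [Store.arr_setReg, Store.arr_setArr, Store.reg_setReg, if_true, Nat.reduceEqDiff,
          if_false, h9'', h10'', hs₅.reg_one, harr, Function.update_apply, hI₃ g hg]
        rcases lt_trichotomy g e with h | rfl | h
        · simp [h.ne, h, Nat.lt_succ_of_lt h]
        · simp [hlev, hmem]
        · simp [h.ne', show ¬ g < e by omega, show ¬ g < e + 1 by omega]
      · rw [hs₅.reg_one] at hlt'
        show ∀ g < m, s₅.arr 3 g = _
        rw [harr]
        refine hkeep fun hcon => ?_
        rcases h with h | h
        · omega
        · exact h.2.2 (hcon.2 _ h.1 h.2.1)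
  · intro s' _ h e he
    have := h e he
    rw [if_pos he] at this
    exact this

/-! ### The programs for one round -/

/-- Set register `22` to the least level of an uncoloured edge and register `23` to such an edge,
or register `22` to the number of edges if this is not larger than that level. Set register `24` to
`1` if all levels are positive, and to `0` otherwise. -/
def scanProg : Prog :=
  .add 22 3 7 ;; .const 23 0 ;; .const 24 1 ;;
  forLt 26 3 (
    .read 28 3 26 ;; .read 27 2 26 ;;
    .ifLt 28 6 (.const 24 0) .skip ;;
    .ifLt 27 6 (.ifLt 28 22 (.add 22 28 7 ;; .add 23 26 7) .skip) .skip)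

theorem wp_scanProg {s : Store} (hmB : m ≤ B) (hs : HoldsGraph n m u w s) :
    wp B scanProg (fun s' => s'.reg 22 ≤ m ∧ (∀ e < m, s.arr 2 e = 0 → s'.reg 22 ≤ s.arr 3 e) ∧
      (s'.reg 22 = m ∨
        (s'.reg 23 < m ∧ s.arr 2 (s'.reg 23) = 0 ∧ s.arr 3 (s'.reg 23) = s'.reg 22)) ∧
      (s'.reg 24 ≠ 0 → ∀ e < m, 1 ≤ s.arr 3 e) ∧ (s'.reg 24 = 0 → ∃ e < m, s.arr 3 e = 0)) s := by
  show wp B (forLt 26 3 _) _ (((s.setReg 22 (s.reg 3 + s.reg 7)).setReg 23 0).setReg 24 1)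
  refine wp_forLt m (by simp [hs.reg_m]) hmB (by simp [hs.reg_one]) rfl rfl rfl (by decide)
    (by decide)
    (fun i s' => s'.reg 22 ≤ m ∧ (∀ e < i, s.arr 2 e = 0 → s'.reg 22 ≤ s.arr 3 e) ∧
      (s'.reg 22 = m ∨
        (s'.reg 23 < m ∧ s.arr 2 (s'.reg 23) = 0 ∧ s.arr 3 (s'.reg 23) = s'.reg 22)) ∧
      (s'.reg 24 ≠ 0 → ∀ e < i, 1 ≤ s.arr 3 e) ∧ (s'.reg 24 = 0 → ∃ e < m, s.arr 3 e = 0))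
    (by simp [hs.reg_m, hs.reg_zero]) ?_ (fun _ _ h => h)
  rintro i hi s₁ hF₁ hsi ⟨h1, h2, h3, h4, h5⟩
  have h6 : s₁.reg 6 = 1 := by rw [hF₁.reg 6 rfl]; simp [hs.reg_one]
  have h7 : s₁.reg 7 = 0 := by rw [hF₁.reg 7 rfl]; simp [hs.reg_zero]
  have ha2 : s₁.arr 2 = s.arr 2 := hF₁.arr 2 rfl
  have ha3 : s₁.arr 3 = s.arr 3 := hF₁.arr 3 rfl
  simp only [wp, Store.reg_setReg, Store.arr_setReg, Nat.reduceEqDiff, if_true, if_false, hsi, h6,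
    h7, ha2, ha3, add_zero]
  have hlt : ∀ {P : ℕ → Prop}, (∀ e < i, P e) → P i → ∀ e < i + 1, P e := by
    intro P h hP e he
    rcases (Nat.lt_succ_iff.1 he).eq_or_lt with rfl | h'
    exacts [hP, h e h']
  refine ⟨fun hl => ⟨fun hc => ⟨fun hb => ?_, fun hb => ?_⟩, fun hc => ?_⟩,
    fun hl => ⟨fun hc => ⟨fun hb => ?_, fun hb => ?_⟩, fun hc => ?_⟩⟩
  · exact ⟨by omega, hlt (fun e he h0 => by have := h2 e he h0; omega) (fun _ => le_rfl),
      Or.inr ⟨hi, by omega, trivial⟩, by simp, fun _ => ⟨i, hi, by omega⟩⟩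
  · exact ⟨h1, hlt h2 (fun _ => by omega), h3, by simp, fun _ => ⟨i, hi, by omega⟩⟩
  · exact ⟨h1, hlt h2 (fun _ => by omega), h3, by simp, fun _ => ⟨i, hi, by omega⟩⟩
  · exact ⟨by omega, hlt (fun e he h0 => by have := h2 e he h0; omega) (fun _ => le_rfl),
      Or.inr ⟨hi, by omega, trivial⟩, fun h => hlt (h4 h) (by omega), h5⟩
  · exact ⟨h1, hlt h2 (fun _ => by omega), h3, fun h => hlt (h4 h) (by omega), h5⟩
  · exact ⟨h1, hlt h2 (fun _ => by omega), h3, fun h => hlt (h4 h) (by omega), h5⟩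

/-- Copy the colours to the output array and increment the number of colours. -/
def saveProg : Prog := forLt 26 3 (.read 27 2 26 ;; .write 1 26 27) ;; .add 4 4 6

theorem wp_saveProg {s : Store} (hmB : m ≤ B) (hs : HoldsGraph n m u w s) :
    wp B saveProg (fun s' => (∀ e < m, s'.arr 1 e = s.arr 2 e) ∧ s'.reg 4 = s.reg 4 + 1) s := by
  show wp B (forLt 26 3 _) _ s
  refine wp_forLt m hs.reg_m hmB hs.reg_one rfl rfl rfl (by decide) (by decide)
    (fun i s' => ∀ e < i, s'.arr 1 e = s.arr 2 e) (by simp) ?_ ?_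
  · intro i hi s₁ hF₁ hsi hI e he
    have ha2 : s₁.arr 2 = s.arr 2 := hF₁.arr 2 rfl
    simp only [Store.reg_setReg, Store.arr_setReg, Store.arr_setArr, Nat.reduceEqDiff, if_true,
      if_false, hsi, ha2, Function.update_apply]
    split_ifs with h
    · rw [h]
    · exact hI e (by omega)
  · intro s₁ hF₁ h
    have h4 : s₁.reg 4 = s.reg 4 := hF₁.reg 4 rfl
    have h6 : s₁.reg 6 = 1 := by rw [hF₁.reg 6 rfl, hs.reg_one]
    exact ⟨h, by simp [h4, h6]⟩

/-- Exchange the uncoloured edge in register `23`, whose level is in register `22`, for a coloured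
edge of lower level. The exchange is carried out tentatively for one candidate after the other, and
undone if the connectivity test fails. -/
def exchangeProg : Prog :=
  .const 25 0 ;;
  forLt 26 3 (
    .ifLt 7 25 .skip (
      .read 27 2 26 ;;
      .ifLt 7 27 (
        .read 28 3 26 ;;
        .ifLt 28 22 (
          .write 2 23 27 ;; .write 2 26 7 ;;
          .add 8 27 7 ;; .add 9 28 7 ;; .add 10 26 7 ;;
          connProg ;;
          .ifLt 7 11 (.const 25 1) (.write 2 26 27 ;; .write 2 23 7)) .skip) .skip))

theorem wp_exchangeProg {s : Store} {k e : ℕ} (hG : GraphBounds B n m u w)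
    (hs : HoldsGraph n m u w s) (h23 : s.reg 23 = e) (he : e < m) (h0 : s.arr 2 e = 0)
    (hlev : ∀ g < m, s.arr 3 g = level (edgeVec u w) (Finset.range m) k (s.arr 2) m g)
    (h22 : s.reg 22 = s.arr 3 e) (hpos : 0 < s.arr 3 e) (hlt : s.arr 3 e < m) :
    wp B exchangeProg (fun s' => ∃ f, s.arr 3 f < s.arr 3 e ∧
      IsExchange (edgeVec u w) (Finset.range m) k (s.arr 2) e f (s.arr 3 f) ∧
      s'.arr 2 = swapColor (s.arr 2) e f) s := by
  have hmB : m ≤ B := by have := hG.le_bound; omega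
  have hmem : ∀ {g}, g < m → g ∈ Finset.range m := fun h => Finset.mem_range.2 h
  show wp B (forLt 26 3 _) _ (s.setReg 25 0)
  refine wp_forLt m (by simp [hs.reg_m]) hmB (by simp [hs.reg_one]) rfl rfl rfl (by decide)
    (by decide)
    (fun i s' => (s'.reg 25 = 0 ∧ s'.arr 2 = s.arr 2 ∧ ∀ f < i, s.arr 3 f < s.arr 3 e →
        ¬ IsExchange (edgeVec u w) (Finset.range m) k (s.arr 2) e f (s.arr 3 f)) ∨
      (s'.reg 25 ≠ 0 ∧ ∃ f, s.arr 3 f < s.arr 3 e ∧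
        IsExchange (edgeVec u w) (Finset.range m) k (s.arr 2) e f (s.arr 3 f) ∧
        s'.arr 2 = swapColor (s.arr 2) e f)) (by simp) ?_ ?_
  · intro f hf s₁ hF₁ hsf hI
    have hr7 : s₁.reg 7 = 0 := by rw [hF₁.reg 7 rfl]; simp [hs.reg_zero]
    have hr22 : s₁.reg 22 = s.arr 3 e := by rw [hF₁.reg 22 rfl]; simp [h22]
    have hr23 : s₁.reg 23 = e := by rw [hF₁.reg 23 rfl]; simp [h23]
    have ha3 : s₁.arr 3 = s.arr 3 := hF₁.arr 3 rfl
    have hs₁ : HoldsGraph n m u w s₁ :=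
      ⟨by rw [hF₁.reg 2 rfl]; simp [hs.reg_n], by rw [hF₁.reg 3 rfl]; simp [hs.reg_m],
        by rw [hF₁.reg 6 rfl]; simp [hs.reg_one], hr7,
        by rw [hF₁.arr 5 rfl]; exact hs.arr_u, by rw [hF₁.arr 6 rfl]; exact hs.arr_w⟩
    rcases hI with ⟨hr25, ha2, hI⟩ | ⟨hr25, hI⟩
    swap
    · refine ⟨fun _ => Or.inr ⟨by simpa using hr25, hI⟩, fun h => ?_⟩
      rw [hr7] at h
      omega
    have hkeep : ∀ s₂ : Store, s₂.reg 25 = 0 → s₂.arr 2 = s.arr 2 →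
        (s.arr 3 f < s.arr 3 e →
          ¬ IsExchange (edgeVec u w) (Finset.range m) k (s.arr 2) e f (s.arr 3 f)) →
        (s₂.reg 25 = 0 ∧ s₂.arr 2 = s.arr 2 ∧ ∀ f' < f + 1, s.arr 3 f' < s.arr 3 e →
          ¬ IsExchange (edgeVec u w) (Finset.range m) k (s.arr 2) e f' (s.arr 3 f')) := by
      refine fun s₂ h h' hn => ⟨h, h', fun f' hf' => ?_⟩
      rcases (Nat.lt_succ_iff.1 hf').eq_or_lt with rfl | hlt'
      exacts [hn, hI f' hlt']
    refine ⟨fun h => by omega, fun _ => ?_⟩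
    show wp B (.ifLt 7 27 _ .skip) _ (s₁.setReg 27 (s₁.arr 2 (s₁.reg 26)))
    rw [hsf, ha2]
    refine ⟨fun hc => ?_, fun hc => ?_⟩
    swap
    · refine Or.inl (hkeep _ (by simpa using hr25) (by simpa using ha2) fun _ hx => hc ?_)
      have := hx.colored
      simp [hr7]
      omega
    replace hc : 0 < s.arr 2 f := by simpa [hr7] using hc
    show wp B (.ifLt 28 22 _ .skip) _
      ((s₁.setReg 27 (s.arr 2 f)).setReg 28 (s₁.arr 3 ((s₁.setReg 27 (s.arr 2 f)).reg 26)))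
    refine ⟨fun hl => ?_, fun hl => ?_⟩
    swap
    · refine Or.inl (hkeep _ (by simpa using hr25) (by simpa using ha2) fun h => absurd ?_ hl)
      simpa [hsf, ha3, hr22] using h
    replace hl : s.arr 3 f < s.arr 3 e := by simpa [hsf, ha3, hr22] using hl
    have hfe : f ≠ e := by rintro rfl; omega
    -- the store in which the exchange has been made and the parameters of the test are set
    obtain ⟨s₂, hs₂⟩ : ∃ s₂ : Store, s₂ =
        ((((((s₁.setReg 27 (s.arr 2 f)).setReg 28 (s.arr 3 f)).setArr 2 e (s.arr 2 f)).setArr 2 f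
          0).setReg 8 (s.arr 2 f)).setReg 9 (s.arr 3 f)).setReg 10 f := ⟨_, rfl⟩
    suffices wp B (connProg ;; .ifLt 7 11 (.const 25 1) (.write 2 26 27 ;; .write 2 23 7))
        (fun s₃ => (s₃.reg 25 = 0 ∧ s₃.arr 2 = s.arr 2 ∧ ∀ f' < f + 1, s.arr 3 f' < s.arr 3 e →
          ¬ IsExchange (edgeVec u w) (Finset.range m) k (s.arr 2) e f' (s.arr 3 f')) ∨
        (s₃.reg 25 ≠ 0 ∧ ∃ f', s.arr 3 f' < s.arr 3 e ∧
          IsExchange (edgeVec u w) (Finset.range m) k (s.arr 2) e f' (s.arr 3 f') ∧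
          s₃.arr 2 = swapColor (s.arr 2) e f')) s₂ by
      simp only [wp, Store.reg_setReg, Store.arr_setReg, Store.reg_setArr, Nat.reduceEqDiff,
        if_true, if_false, hsf, ha3, hr7, hr23, add_zero]
      simp only [wp, hs₂] at this
      simpa using this
    have hs₂G : HoldsGraph n m u w s₂ := by
      subst hs₂
      exact ⟨by simp [hs₁.reg_n], by simp [hs₁.reg_m], by simp [hs₁.reg_one],
        by simp [hs₁.reg_zero], by simpa using hs₁.arr_u, by simpa using hs₁.arr_w⟩
    have hs₂a : s₂.arr 2 = swapColor (s.arr 2) e f := by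
      subst hs₂
      simp [swapColor, ha2]
    have hs₂l : s₂.arr 3 = s.arr 3 := by
      subst hs₂
      simp [ha3]
    have hs₂r : s₂.reg 8 = s.arr 2 f ∧ s₂.reg 9 = s.arr 3 f ∧ s₂.reg 10 = f ∧ s₂.reg 23 = e ∧
        s₂.reg 25 = 0 ∧ s₂.reg 26 = f ∧ s₂.reg 27 = s.arr 2 f := by
      subst hs₂
      simp [hr23, hr25, hsf]
    obtain ⟨h8, h9, h10, h23', h25, h26, h27⟩ := hs₂r
    have hcl : colorLevel m s₂ (s.arr 2 f) (s.arr 3 f) =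
        layer (edgeVec u w) (Finset.range m) k (s.arr 2) (s.arr 3 f) ∩
          swapColor (s.arr 2) e f ⁻¹' {s.arr 2 f} := by
      have hlay : ∀ g < m, s.arr 3 f ≤ s₂.arr 3 g ↔
          g ∈ layer (edgeVec u w) (Finset.range m) k (s.arr 2) (s.arr 3 f) := fun g hg => by
        rw [hs₂l, hlev g hg]
        exact le_level_iff (by omega) (hmem hg)
      ext g
      simp only [colorLevel, hs₂a, Set.mem_ofPred_eq, Set.mem_inter_iff, Set.mem_preimage,
        Set.mem_singleton_iff]
      constructor
      · rintro ⟨hg, hc', ht⟩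
        exact ⟨(hlay g hg).1 ht, hc'⟩
      · rintro ⟨hg', hc'⟩
        have hg : g < m := Finset.mem_range.1 (layer_subset _ hg')
        exact ⟨hg, hc', (hlay g hg).2 hg'⟩
    have hiff : IsExchange (edgeVec u w) (Finset.range m) k (s.arr 2) e f (s.arr 3 f) ↔
        f ∈ linClosure (edgeVec u w) (colorLevel m s₂ (s.arr 2 f) (s.arr 3 f)) := by
      rw [hcl]
      refine ⟨fun hx => hx.circuit, fun hx => ⟨h0, hc, ?_, ?_, ?_, hx⟩⟩
      · have hl' := hl
        rw [hlev e he] at hl'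
        exact (le_level_iff (by omega) (hmem he)).1 hl'
      · rw [hlev f hf]
        exact mem_layer_level (hmem hf)
      · rw [hlev f hf]
        exact notMem_layer_level_succ (hmem hf) (by rw [← hlev f hf]; omega)
    show wp B connProg _ s₂
    refine wp_conseq (wp_connProg hG hs₂G (by rw [h10]; exact hf)) fun s₃ hF₃ h => ?_
    rw [h8, h9, h10, ← hiff] at h
    have hs₃ := hs₂G.of_frame hF₃ rfl
    have h23'' : s₃.reg 23 = e := by rw [hF₃.reg 23 rfl, h23']
    have h25' : s₃.reg 25 = 0 := by rw [hF₃.reg 25 rfl, h25]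
    have h26' : s₃.reg 26 = f := by rw [hF₃.reg 26 rfl, h26]
    have h27' : s₃.reg 27 = s.arr 2 f := by rw [hF₃.reg 27 rfl, h27]
    have ha2' : s₃.arr 2 = swapColor (s.arr 2) e f := by rw [hF₃.arr 2 rfl, hs₂a]
    refine ⟨fun ht => Or.inr ⟨by simp, f, hl, h.1 ?_, by simpa using ha2'⟩, fun ht => Or.inl ?_⟩
    · rw [hs₃.reg_zero] at ht
      omega
    · rw [hs₃.reg_zero] at ht
      refine hkeep _ (by simpa using h25') ?_ fun _ hx => ht (Nat.pos_of_ne_zero (h.2 hx))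
      simp only [Store.arr_setArr, Store.reg_setArr, if_true, h26', h27', h23'', hs₃.reg_zero, ha2']
      funext g
      simp only [Function.update_apply, swapColor]
      split_ifs <;> simp_all
  · rintro s' - (⟨-, -, h⟩ | ⟨-, h⟩)
    · exfalso
      have hl := hlev e he
      obtain ⟨f, hf, hfl, hx⟩ := exists_isExchange (v := edgeVec u w) (X := Finset.range m) (k := k)
        (col := s.arr 2) (t := m) (hmem he) h0 (by omega) (by omega)
      have hf' := Finset.mem_range.1 hf
      rw [← hlev f hf'] at hx hfl
      exact h f hf' (by omega) hx
    · exact h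

/-! ### Correctness of a round -/

/-- The colours `1, …, k` all span all of the edges `0, …, m - 1`. -/
def AllSpanning (m : ℕ) (u w : ℕ → ℕ) (k : ℕ) (col : ℕ → ℕ) : Prop :=
  ∀ i, 1 ≤ i → i ≤ k →
    (Finset.range m : Set ℕ) ⊆ linClosure (edgeVec u w) (↑(Finset.range m) ∩ col ⁻¹' {i})

/-- The invariant of the main loop: there is an independent colouring with `k` colours in
array `2`, and one with `k - 1` spanning colours in the output array. -/
structure Invariant (n m : ℕ) (u w : ℕ → ℕ) (k : ℕ) (s : Store) : Prop where
  graph : HoldsGraph n m u w s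
  reg_k : s.reg 4 = k
  pos : 1 ≤ k
  le : k ≤ m + 1
  coloring : IsIndepColoring (edgeVec u w) (Finset.range m) k (s.arr 2)
  saved : AllSpanning m u w (k - 1) (s.arr 1)

/-- The colouring with `k` colours admits no augmentation although some colour is not spanning. -/
def IsStuck (m : ℕ) (u w : ℕ → ℕ) (k : ℕ) (col : ℕ → ℕ) : Prop :=
  (∀ e ∈ Finset.range m, col e = 0 → e ∈ layer (edgeVec u w) (Finset.range m) k col m) ∧
    ∃ i, 1 ≤ i ∧ i ≤ k ∧ ∃ e ∈ Finset.range m,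
      e ∉ linClosure (edgeVec u w) (↑(Finset.range m) ∩ col ⁻¹' {i})

theorem Invariant.congr {k : ℕ} {s s' : Store} {p : Prog} (h : Invariant n m u w k s)
    (hF : Frame p s s') (hp : keepsGraph p = true) (h4 : p.writesReg 4 = false)
    (h1 : p.writesArr 1 = false)
    (hc : IsIndepColoring (edgeVec u w) (Finset.range m) k (s'.arr 2)) :
    Invariant n m u w k s' :=
  ⟨h.graph.of_frame hF hp, (hF.reg 4 h4).trans h.reg_k, h.pos, h.le, hc,
    by rw [hF.arr 1 h1]; exact h.saved⟩

/-- Colour the edge in register `23`, whose level is zero, with a colour that does not span it. -/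
def augmentProg : Prog := .add 10 23 7 ;; .const 9 0 ;; spanProg ;; .write 2 23 21

theorem wp_augmentProg {s : Store} {k e : ℕ} (hG : GraphBounds B n m u w)
    (hs : HoldsGraph n m u w s) (hk : s.reg 4 = k) (hkB : k ≤ B) (h23 : s.reg 23 = e) (he : e < m)
    (h0 : e ∉ layer (edgeVec u w) (Finset.range m) k (s.arr 2) 1) :
    wp B augmentProg (fun s' => ∃ c, 1 ≤ c ∧ c ≤ k ∧
      e ∉ linClosure (edgeVec u w) (↑(Finset.range m) ∩ s.arr 2 ⁻¹' {c}) ∧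
      s'.arr 2 = Function.update (s.arr 2) e c) s := by
  obtain ⟨s₁, hs₁⟩ : ∃ s₁ : Store, s₁ = (s.setReg 10 e).setReg 9 0 := ⟨_, rfl⟩
  suffices wp B (spanProg ;; .write 2 23 21) (fun s' => ∃ c, 1 ≤ c ∧ c ≤ k ∧
      e ∉ linClosure (edgeVec u w) (↑(Finset.range m) ∩ s.arr 2 ⁻¹' {c}) ∧
      s'.arr 2 = Function.update (s.arr 2) e c) s₁ by
    rw [hs₁] at this
    show wp B (spanProg ;; .write 2 23 21) _ ((s.setReg 10 (s.reg 23 + s.reg 7)).setReg 9 0)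
    rwa [hs.reg_zero, h23, add_zero]
  have hs₁G : HoldsGraph n m u w s₁ := by
    subst hs₁
    exact ⟨by simp [hs.reg_n], by simp [hs.reg_m], by simp [hs.reg_one], by simp [hs.reg_zero],
      hs.arr_u, hs.arr_w⟩
  have ha2 : s₁.arr 2 = s.arr 2 := by subst hs₁; rfl
  have hr : s₁.reg 4 = k ∧ s₁.reg 9 = 0 ∧ s₁.reg 10 = e ∧ s₁.reg 23 = e := by
    subst hs₁
    simp [hk, h23]
  obtain ⟨hr4, hr9, hr10, hr23⟩ := hr
  show wp B spanProg _ s₁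
  refine wp_conseq (wp_spanProg (k := k) hG hs₁G hr4 hkB (by rw [hr10]; exact he)) fun s₂ hF h => ?_
  have hcl : ∀ i, colorLevel m s₁ i 0 =
      layer (edgeVec u w) (Finset.range m) k (s.arr 2) 0 ∩ s.arr 2 ⁻¹' {i} := fun i =>
    colorLevel_eq_layer_inter ha2 (fun g hg => by simpa [layer] using hg) i
  simp only [hr9, hr10, hcl] at h
  rcases h with h | ⟨h1, h2, h3⟩
  · exact absurd ⟨by simpa [layer] using he, h.2⟩ h0
  · refine ⟨s₂.reg 21, h1, h2, h3, ?_⟩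
    have h23' : s₂.reg 23 = e := by rw [hF.reg 23 rfl, hr23]
    have ha2' : s₂.arr 2 = s.arr 2 := by rw [hF.arr 2 rfl, ha2]
    simp only [Store.arr_setArr, if_true, h23', ha2']

/-- One round of the algorithm: if all colours are spanning, save the colouring and introduce a new
colour. Otherwise colour an edge, or exchange an uncoloured edge for one of lower level, or stop. -/
def roundProg : Prog :=
  levelProg ;; scanProg ;;
  .ifLt 7 24 saveProg
    (.ifLt 22 3 (.ifLt 22 6 augmentProg exchangeProg) (.const 5 0))

theorem wp_roundProg {s : Store} {k : ℕ} (hG : GraphBounds B n m u w)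
    (hK : ∀ k col, AllSpanning m u w k col → k ≤ m) (h : Invariant n m u w k s)
    (h5 : s.reg 5 = 1) :
    wp B roundProg (fun s' =>
      (s'.reg 5 = 1 ∧ ∃ k', Invariant n m u w k' s' ∧
        potential (edgeVec u w) (Finset.range m) k' (s'.arr 2) <
          potential (edgeVec u w) (Finset.range m) k (s.arr 2)) ∨
      (s'.reg 5 = 0 ∧ Invariant n m u w k s' ∧ IsStuck m u w k (s'.arr 2))) s := by
  have hmB : m ≤ B := by have := hG.le_bound; omega
  have hkB : k ≤ B := h.le.trans hG.le_bound
  have hmem : ∀ {g}, g < m → g ∈ Finset.range m := fun h => Finset.mem_range.2 h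
  have hcard : (Finset.range m).card = m := Finset.card_range m
  show wp B levelProg _ s
  refine wp_conseq (wp_levelProg hG h.graph h.reg_k hkB) fun s₁ hF₁ hlev => ?_
  have hg₁ := h.graph.of_frame hF₁ rfl
  show wp B scanProg _ s₁
  refine wp_conseq (wp_scanProg hmB hg₁) fun s₂ hF₂ hscan => ?_
  have ha2 : s₂.arr 2 = s.arr 2 := by rw [hF₂.arr 2 rfl, hF₁.arr 2 rfl]
  have ha3 : s₂.arr 3 = s₁.arr 3 := by rw [hF₂.arr 3 rfl]
  have hr5 : s₂.reg 5 = 1 := by rw [hF₂.reg 5 rfl, hF₁.reg 5 rfl, h5]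
  have h₂ : Invariant n m u w k s₂ :=
    (h.congr hF₁ rfl rfl rfl (by rw [hF₁.arr 2 rfl]; exact h.coloring)).congr hF₂ rfl rfl rfl
      (by rw [ha2]; exact h.coloring)
  rw [← hF₂.arr 2 rfl, ← ha3] at hscan
  rw [← ha3, ← ha2] at hlev
  rw [← ha2]
  clear hF₁ hF₂ hg₁ ha2 ha3 h5 h
  obtain ⟨hb, hmin, hbest, hfull, hnfull⟩ := hscan
  have hpos : ∀ {g}, g < m → (1 ≤ s₂.arr 3 g ↔
      g ∈ layer (edgeVec u w) (Finset.range m) k (s₂.arr 2) 1) := fun hg => by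
    rw [hlev _ hg]
    exact le_level_iff (by omega) (hmem hg)
  refine ⟨fun hf => ?_, fun hf => ?_⟩
  · rw [h₂.graph.reg_zero] at hf
    have hall : AllSpanning m u w k (s₂.arr 2) := fun i hi hik e he =>
      ((hpos (Finset.mem_range.1 he)).1 (hfull (by omega) e (Finset.mem_range.1 he))).2 i hi hik
    have hkm := hK k _ hall
    refine wp_conseq (wp_saveProg hmB h₂.graph) fun s₃ hF₃ ⟨hout, hr4⟩ => Or.inl ?_
    have ha2 : s₃.arr 2 = s₂.arr 2 := hF₃.arr 2 rfl
    refine ⟨(hF₃.reg 5 rfl).trans hr5, k + 1,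
      ⟨h₂.graph.of_frame hF₃ rfl, by rw [hr4, h₂.reg_k], by omega, by omega, ?_, ?_⟩, ?_⟩
    · rw [ha2]
      exact ⟨fun e he => (h₂.coloring.le e he).trans (Nat.le_succ k), h₂.coloring.indep⟩
    · intro i hi hik e he
      refine linClosure_mono ?_ (hall i hi (by omega) he)
      rintro g ⟨hg, hgi⟩
      refine ⟨hg, ?_⟩
      have := hout g (by simpa using hg)
      simp only [Set.mem_preimage, Set.mem_singleton_iff] at hgi ⊢
      omega
    · rw [ha2]
      exact potential_succ_lt (by omega)
  rw [h₂.graph.reg_zero] at hf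
  obtain ⟨e₀, he₀, hle₀⟩ := hnfull (by omega)
  refine ⟨fun hlt => ?_, fun hlt => ?_⟩
  · rw [h₂.graph.reg_m] at hlt
    obtain ⟨he, h0, hbe⟩ := hbest.resolve_left hlt.ne
    have hml : minLevel (edgeVec u w) (Finset.range m) k (s₂.arr 2) = s₂.reg 22 := by
      refine minLevel_eq (by omega) (fun g hg hg0 => ?_)
        (Or.inr ⟨s₂.reg 23, hmem he, h0, ?_⟩)
      · rw [hcard, ← hlev g (Finset.mem_range.1 hg)]
        exact hmin g (Finset.mem_range.1 hg) hg0
      · rw [hcard, ← hlev _ he, hbe]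
    refine ⟨fun hlt' => ?_, fun hlt' => ?_⟩
    · rw [h₂.graph.reg_one] at hlt'
      refine wp_conseq (wp_augmentProg hG h₂.graph h₂.reg_k hkB rfl he fun hcon => ?_)
        fun s₃ hF₃ ⟨c, hc, hck, hn, ha2⟩ => Or.inl ?_
      · have := (hpos he).2 hcon
        omega
      · refine ⟨(hF₃.reg 5 rfl).trans hr5, k, h₂.congr hF₃ rfl rfl rfl ?_, ?_⟩
        · rw [ha2]
          exact h₂.coloring.update h0 hc hck hn
        · rw [ha2]
          exact potential_update_lt (hmem he) h0 hc
    · rw [h₂.graph.reg_one] at hlt'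
      refine wp_conseq (wp_exchangeProg (k := k) hG h₂.graph rfl he h0 hlev hbe.symm (by omega)
        (by omega)) fun s₃ hF₃ ⟨f, hfe, hx, ha2⟩ => Or.inl ?_
      refine ⟨(hF₃.reg 5 rfl).trans hr5, k, h₂.congr hF₃ rfl rfl rfl ?_, ?_⟩
      · rw [ha2]
        exact hx.isIndepColoring h₂.coloring
      · rw [ha2]
        exact hx.potential_lt h₂.coloring (by omega)
  · rw [h₂.graph.reg_m] at hlt
    have hF₃ : Frame (.const 5 0) s₂ (s₂.setReg 5 0) := by
      refine ⟨fun r hr => ?_, fun _ _ => rfl⟩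
      have : r ≠ 5 := by rintro rfl; simp [Prog.writesReg] at hr
      simp [this]
    refine Or.inr ⟨by simp, h₂.congr hF₃ rfl rfl rfl h₂.coloring, fun g hg hg0 => ?_, ?_⟩
    · have hg' := Finset.mem_range.1 hg
      have := hmin g hg' hg0
      rw [hlev g hg'] at this
      show g ∈ layer (edgeVec u w) (Finset.range m) k (s₂.arr 2) m
      exact (le_level_iff le_rfl hg).1 (by omega)
    · have hn := mt (hpos he₀).2 (by omega)
      by_contra! hcon
      exact hn ⟨hmem he₀, fun i hi hik => hcon i hi hik e₀ (hmem he₀)⟩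

/-! ### The complete programs -/

/-- Read the graph from the input. -/
def initProg : Prog :=
  .const 6 1 ;; .read 2 0 7 ;; .read 3 0 6 ;; .const 27 2 ;;
  forLt 26 3 (
    .read 28 0 27 ;; .write 5 26 28 ;; .add 27 27 6 ;;
    .read 28 0 27 ;; .write 6 26 28 ;; .add 27 27 6) ;;
  .const 4 1 ;; .const 5 1

theorem wp_initProg (L : List ℕ) (hB : L.getD 1 0 ≤ B) :
    wp B initProg (fun s => HoldsGraph (L.getD 0 0) (L.getD 1 0) (fun e => L.getD (2 + 2 * e) 0)
      (fun e => L.getD (3 + 2 * e) 0) s ∧ s.reg 4 = 1 ∧ s.reg 5 = 1 ∧ s.arr 2 = fun _ => 0)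
      (Store.start L) := by
  obtain ⟨s₁, hs₁⟩ : ∃ s₁ : Store, s₁ = ((((Store.start L).setReg 6 1).setReg 2
    (L.getD 0 0)).setReg 3 (L.getD 1 0)).setReg 27 2 := ⟨_, rfl⟩
  suffices wp B (forLt 26 3 (.read 28 0 27 ;; .write 5 26 28 ;; .add 27 27 6 ;;
      .read 28 0 27 ;; .write 6 26 28 ;; .add 27 27 6) ;; .const 4 1 ;; .const 5 1)
      (fun s => HoldsGraph (L.getD 0 0) (L.getD 1 0) (fun e => L.getD (2 + 2 * e) 0)
        (fun e => L.getD (3 + 2 * e) 0) s ∧ s.reg 4 = 1 ∧ s.reg 5 = 1 ∧ s.arr 2 = fun _ => 0)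
      s₁ by
    rw [hs₁] at this
    exact this
  have hr : s₁.reg 2 = L.getD 0 0 ∧ s₁.reg 3 = L.getD 1 0 ∧ s₁.reg 6 = 1 ∧ s₁.reg 7 = 0 ∧
      s₁.reg 27 = 2 := by
    subst hs₁
    simp [Store.start]
  have ha : s₁.arr 0 = (fun i => L.getD i 0) ∧ s₁.arr 2 = fun _ => 0 := by
    subst hs₁
    exact ⟨rfl, rfl⟩
  obtain ⟨h2, h3, h6, h7, h27⟩ := hr
  refine wp_forLt (L.getD 1 0) h3 hB h6 rfl rfl rfl (by decide) (by decide)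
    (fun i s => s.reg 27 = 2 + 2 * i ∧ ∀ e < i, s.arr 5 e = L.getD (2 + 2 * e) 0 ∧
      s.arr 6 e = L.getD (3 + 2 * e) 0) (by simp [h27]) ?_ ?_
  · rintro i hi s hF hsi ⟨hp, hI⟩
    have h6' : s.reg 6 = 1 := by rw [hF.reg 6 rfl, h6]
    have ha0 : s.arr 0 = (fun i => L.getD i 0) := by rw [hF.arr 0 rfl, ha.1]
    simp only [wp, Store.reg_setReg, Store.arr_setReg, Store.reg_setArr, Store.arr_setArr,
      Nat.reduceEqDiff, if_true, if_false, h6', ha0, hsi, hp, OfNat.zero_ne_ofNat]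
    refine ⟨by ring, fun e he => ?_⟩
    simp only [Function.update_apply]
    split_ifs with h
    · subst h
      exact ⟨rfl, by rw [show 2 + 2 * e + 1 = 3 + 2 * e by ring]⟩
    · exact hI e (by omega)
  · rintro s hF ⟨-, hI⟩
    refine ⟨⟨?_, ?_, ?_, ?_, fun e he => (hI e he).1, fun e he => (hI e he).2⟩, by simp, by simp,
      (hF.arr 2 rfl).trans ha.2⟩
    · simpa [h2] using hF.reg 2 rfl
    · simpa [h3] using hF.reg 3 rfl
    · simpa [h6] using hF.reg 6 rfl
    · simpa [h7] using hF.reg 7 rfl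

/-- Pack as many disjoint spanning trees as possible. -/
def packProg : Prog := initProg ;; .whileLt 7 5 roundProg

/-- A bound for the number of rounds on a graph with `m` edges. -/
def roundBound (m : ℕ) : ℕ := (2 * m + 2) * (m + 1) + m + 1

theorem wp_packProg (x : SCGInstance)
    (hK : ∀ k col, AllSpanning x.m x.fstEnd x.sndEnd k col → k ≤ x.m) :
    wp (roundBound x.m) packProg (fun s => ∃ k, Invariant x.n x.m x.fstEnd x.sndEnd k s ∧
      IsStuck x.m x.fstEnd x.sndEnd k (s.arr 2)) (Store.start x.encode) := by
  have hB : x.m + 1 ≤ roundBound x.m := by unfold roundBound; omega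
  have hG : GraphBounds (roundBound x.m) x.n x.m x.fstEnd x.sndEnd :=
    ⟨x.n_le, fun _ he => x.fstEnd_lt he, fun _ he => x.sndEnd_lt he, hB⟩
  show wp _ initProg _ _
  refine wp_conseq (wp_initProg x.encode (by
    simp only [SCGInstance.encode, List.getD_cons_succ, List.getD_cons_zero]; omega)) ?_
  rintro s - ⟨hs, h4, h5, h2⟩
  have h0 : Invariant x.n x.m x.fstEnd x.sndEnd 1 s := by
    refine ⟨hs, h4, le_rfl, by omega, ⟨fun e _ => by simp [h2], fun i hi => ?_⟩, fun i hi hi' => ?_⟩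
    · have : ((Finset.range x.m : Set ℕ) ∩ s.arr 2 ⁻¹' {i}) = ∅ := by
        ext e
        simp only [h2, Set.mem_inter_iff, Set.mem_preimage, Set.mem_singleton_iff,
          Set.mem_empty_iff_false, iff_false, not_and]
        omega
      rw [this]
      exact linearIndepOn_empty ℚ _
    · omega
  refine ⟨fun j s => (s.reg 5 = 1 ∧ ∃ k, Invariant x.n x.m x.fstEnd x.sndEnd k s ∧
      potential x.vec (Finset.range x.m) k (s.arr 2) < j) ∨
    (s.reg 5 = 0 ∧ ∃ k, Invariant x.n x.m x.fstEnd x.sndEnd k s ∧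
      IsStuck x.m x.fstEnd x.sndEnd k (s.arr 2)), ⟨roundBound x.m, le_rfl,
      Or.inl ⟨h5, 1, h0, ?_⟩⟩, ?_, ?_⟩
  · have := potential_le (v := x.vec) (X := Finset.range x.m) (k := 1) (col := s.arr 2)
    rw [Finset.card_range] at this
    exact Nat.lt_succ_of_le this
  · rintro j s₁ (⟨h5, k, h, hj⟩ | ⟨h5, k, h, hj⟩) hlt
    · refine wp_conseq (wp_roundProg hG hK h h5) ?_
      rintro s₂ - (⟨h5', k', h', hj'⟩ | ⟨h5', h'⟩)
      · exact ⟨_, hj, Or.inl ⟨h5', k', h', hj'⟩⟩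
      · exact ⟨0, by omega, Or.inr ⟨h5', k, h'⟩⟩
    · rw [h5] at hlt
      omega
  · rintro j s₁ (⟨h5, k, h, hj⟩ | ⟨h5, h⟩) hlt
    · rw [h5, h.graph.reg_zero] at hlt
      omega
    · exact h

end RAM

/-! ### Correctness and running time on connected graphs -/

namespace SCGInstance

open RAM

variable (x : SCGInstance)

theorem exists_isSpanningTree_of_allSpanning {k : ℕ} {f : ℕ → ℕ}
    (h : AllSpanning x.m x.fstEnd x.sndEnd k f) {i : ℕ} (hi : i ∈ Finset.Icc 1 k) :
    ∃ T : Finset (Fin x.m), (∀ e ∈ T, f e = i) ∧ IsSpanningTree x.ends T :=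
  x.exists_isSpanningTree (h i (Finset.mem_Icc.1 hi).1 (Finset.mem_Icc.1 hi).2)

theorem hasDisjointSpanningTrees_of_allSpanning {k : ℕ} {f : ℕ → ℕ}
    (h : AllSpanning x.m x.fstEnd x.sndEnd k f) : HasDisjointSpanningTrees x.ends k := by
  classical
  have := hasDisjointSpanningTrees_of_pairwiseDisjoint (ends := x.ends) (Finset.Icc 1 k)
    (fun i => Finset.univ.filter fun e : Fin x.m => f e = i) (fun i hi => ?_) ?_
  · simpa using this
  · obtain ⟨T, hT, hT'⟩ := x.exists_isSpanningTree_of_allSpanning h hi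
    exact ⟨T, fun e he => by simpa using hT e he, hT'⟩
  · intro i _ j _ hij
    refine Finset.disjoint_left.2 fun e he he' => hij ?_
    simp only [Finset.mem_filter] at he he'
    exact he.2.symm.trans he'.2

theorem not_hasDisjointSpanningTrees_of_isStuck {k : ℕ} {col : ℕ → ℕ}
    (hc : IsIndepColoring x.vec (Finset.range x.m) k col)
    (h : IsStuck x.m x.fstEnd x.sndEnd k col) : ¬ HasDisjointSpanningTrees x.ends k := by
  rintro ⟨F, hF, hT, hd⟩
  obtain ⟨hU, i, hi, hik, e, he, hn⟩ := h
  refine not_pairwiseDisjoint_spanning hc (by simpa using hU) hi hik he hn F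
    (fun T => T.map Fin.valEmbedding) hF (fun T _ g hg => ?_)
    (fun T hTF => x.subset_linClosure_of_isSpanningTree (hT T hTF)) fun T hTF T' hTF' hne => ?_
  · obtain ⟨a, -, rfl⟩ := Finset.mem_map.1 hg
    simp
  · exact (Finset.disjoint_map _).2 (hd hTF hTF' hne)

/-- The packing program on a graph: it halts with `k + 1` in register `4` and with a colouring in
the output array whose colours `1, …, k` span, and `k` is the largest number of disjoint spanning
trees. -/
theorem wp_packProg : wp (roundBound x.m) packProg (fun s => ∃ k, s.reg 3 = x.m ∧ s.reg 4 = k + 1 ∧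
    s.reg 6 = 1 ∧ s.reg 7 = 0 ∧ AllSpanning x.m x.fstEnd x.sndEnd k (s.arr 1) ∧
    IsGreatest {j | HasDisjointSpanningTrees x.ends j} k) (Store.start x.encode) := by
  refine wp_conseq (RAM.wp_packProg x fun k col h => ?_) ?_
  · simpa using (x.hasDisjointSpanningTrees_of_allSpanning h).le_card
  · rintro s - ⟨k, h, hst⟩
    have hpos := h.pos
    refine ⟨k - 1, h.graph.reg_m, by rw [h.reg_k]; omega, h.graph.reg_one, h.graph.reg_zero,
      h.saved, x.hasDisjointSpanningTrees_of_allSpanning h.saved, fun j hj => ?_⟩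
    by_contra! hcon
    exact x.not_hasDisjointSpanningTrees_of_isStuck h.coloring hst (hj.mono (by omega))

theorem m_le_bitLength : x.m ≤ bitLength x.encode := by
  have h1 : ∀ L : List ℕ, L.length ≤ bitLength L := by
    intro L
    induction L with
    | nil => simp
    | cons c L ih =>
      simp only [bitLength, List.map_cons, List.sum_cons, List.length_cons] at ih ⊢
      omega
  refine le_trans ?_ (h1 _)
  simp only [encode, List.length_cons, List.length_flatMap, List.length_nil, List.map_const',
    List.length_ofFn, List.sum_replicate, smul_eq_mul]
  omega

/-- A verified program runs in polynomial time if its loop bound is polynomial in the number of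
edges, as this number is at most the length of the input. -/
theorem solvableInPolyTime_of_wp {Sol : SCGInstance → List ℕ → Prop} (P : Prog)
    (h : ∀ x : SCGInstance, wp (roundBound x.m) P (fun s => Sol x s.output)
      (Store.start x.encode)) : SolvableInPolyTime encode Sol := by
  obtain ⟨f, hf⟩ := P.exists_polynomial_cost
  refine ⟨P, f.comp ((2 * Polynomial.X + 2) * (Polynomial.X + 1) + Polynomial.X + 1), fun x => ?_⟩
  obtain ⟨t, s, hexec, ht, hs⟩ := exists_exec_of_wp (h x)
  refine ⟨t, s, hexec, ht.trans ?_, hs⟩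
  have hmono : roundBound x.m ≤ roundBound (bitLength x.encode) := by
    have := x.m_le_bitLength
    unfold roundBound
    gcongr
  refine (P.cost_mono hmono).trans_eq ?_
  simp [hf, roundBound]

end SCGInstance

theorem mainTheorem10 :
    RAM.SolvableInPolyTime SCGInstance.encode
        (fun x L => ∃ π : CoalitionStructure (Fin x.m), Represents L π ∧ x.game.IsOptimal π) ∧
      (∀ (x : SCGInstance) (π : CoalitionStructure (Fin x.m)), x.game.IsOptimal π →
        ∃ k : ℕ, x.game.welfare π = k ∧ IsGreatest {j | HasDisjointSpanningTrees x.ends j} k) ∧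
      RAM.SolvableInPolyTime SCGInstance.encode
        (fun x L => ∃ k : ℕ, L = [k] ∧ IsGreatest {j | HasDisjointSpanningTrees x.ends j} k) := by
  refine ⟨?_, fun x π hπ => exists_isGreatest_of_isOptimal hπ, ?_⟩
  -- The colouring in array `1` is the output, so only its length has to be set.
  · refine SCGInstance.solvableInPolyTime_of_wp (RAM.packProg ;; .add 1 3 7) fun x => ?_
    show RAM.wp _ RAM.packProg _ _
    refine RAM.wp_conseq x.wp_packProg ?_
    rintro s - ⟨k, h3, h4, h6, h7, hall, -, hmax⟩
    refine ⟨labelPartition fun e : Fin x.m => s.arr 1 e, ⟨?_, fun i j => ?_⟩, fun π' => ?_⟩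
    · simp [RAM.Store.output, h3, h7]
    · rw [exists_mem_labelPartition]
      simp only [RAM.Store.output, List.get_eq_getElem, List.getElem_map, List.getElem_range]
      exact Iff.rfl
    · obtain ⟨j, hj, hd⟩ := exists_welfare_eq (ends := x.ends) π'
      have hle : (j : ℝ) ≤ k := by exact_mod_cast hmax hd
      have := card_le_welfare_labelPartition (ends := x.ends) (fun e : Fin x.m => s.arr 1 e)
        (Finset.Icc 1 k) fun i hi => x.exists_isSpanningTree_of_allSpanning hall hi
      rw [Nat.card_Icc, Nat.add_sub_cancel] at this
      exact (hj.le.trans hle).trans this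
  -- Register `4` exceeds the number of trees by one.
  · refine SCGInstance.solvableInPolyTime_of_wp
      (RAM.packProg ;; .sub 27 4 6 ;; .write 1 7 27 ;; .const 1 1) fun x => ?_
    show RAM.wp _ RAM.packProg _ _
    refine RAM.wp_conseq x.wp_packProg ?_
    rintro s - ⟨k, h3, h4, h6, h7, hall, hk⟩
    refine ⟨k, ?_, hk⟩
    simp [RAM.Store.output, h4, h6, h7]
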